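/- Let $\mathcal A=\{A_1,\dots,A_m\}$ be a finite family of real $d\times d$ matrices that is irreducible, i.e. the $A_i$ have no common invariant linear subspace of $\mathbb R^d$ other than $\{0\}$ and $\mathbb R^d$. Let $\rho(\mathcal A)=\lim_{n\to\infty}\max_{s_1,\dots,s_n}\|A_{s_n}\cdots A_{s_1}\|^{1/n}$ be its joint spectral radius. Products of matrices from $\mathcal A$ are identified with words $s_1\dots s_k$, $k\ge 1$, in the alphabet $\{1,\dots,m\}$, the word $s_1\dots s_k$ standing for $S=A_{s_k}\cdots A_{s_1}$; put $|S|=k$ and $\nu(S)=\rho(S)^{1/|S|}$, where $\rho(S)$ is the largest modulus of a complex eigenvalue of $S$. Powers and cyclic permutations of products are those of words, and a product is primitive if it is not a power of a shorter product. Suppose that $\mathcal A$ has a unique dominant product $\Pi$: $\Pi$ is primitive and there is $\varepsilon\in(0,1)$ such that $\nu(S)\le(1-\varepsilon)^{1/|S|}\,\nu(\Pi)$ for every product $S$ that is not a power of $\Pi$ or of one of its cyclic permutations. Suppose also that the leading eigenvalue $\lambda\in\mathbb C$ of $\Pi$ is unique and simple: it is a simple root of the characteristic polynomial of $\Pi$,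 and every eigenvalue of $\Pi$ other than $\lambda$ and $\bar\lambda$ is strictly smaller than $\lambda$ in modulus. Suppose finally that $\lambda$ is either real or non-real with $\arg(\lambda)/\pi$ irrational. A convex body is a convex compact subset of $\mathbb R^d$ with nonempty interior that is symmetric about the origin; a convex body $G$ is invariant for $\mathcal A$ if $\mathrm{co}\bigl(\bigcup_{i=1}^m A_iG\bigr)=\rho(\mathcal A)\,G$. Then $\mathcal A$ possesses an invariant body, and it is unique up to multiplication by a positive constant. If $\lambda$ is real, this body is a polytope (the convex hull of finitely many points). If $\lambda$ is non-real with $\arg(\lambda)/\pi$ irrational, it is the convex hull of finitely many ellipses, where an ellipse is a set $\{a\,x+b\,y : a,b\in\mathbb R,\ a^2+b^2=1\}$ with $x,y\in\mathbb R^d$ (it degenerates to a segment if $x,y$ are linearly dependent). -/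

import Mathlib

open scoped Pointwise

namespace SwitchingSystem

/-- The operator on `ℝ^d` (with its Euclidean structure) given by a real `d × d` matrix. -/
noncomputable abbrev op {d : ℕ} (M : Matrix (Fin d) (Fin d) ℝ) :
    EuclideanSpace ℝ (Fin d) →L[ℝ] EuclideanSpace ℝ (Fin d) :=
  Matrix.toEuclideanCLM (n := Fin d) (𝕜 := ℝ) M

/-- The product `A_{s_k} ⋯ A_{s_1}` associated with the word `s_1 … s_k`
(the order of the factors is inverse to the order of the letters). -/
def wordProd {d m : ℕ} (A : Fin m → Matrix (Fin d) (Fin d) ℝ) (w : List (Fin m)) :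
    Matrix (Fin d) (Fin d) ℝ :=
  ((w.map A).reverse).prod

/-- The joint spectral radius `lim_{n → ∞} max_{Π ∈ A^n} ‖Π‖^{1/n}`. The limit exists for every
nonempty finite family and does not depend on the norm; here it is the Euclidean operator norm. -/
noncomputable def jsr {d m : ℕ} (A : Fin m → Matrix (Fin d) (Fin d) ℝ) : ℝ :=
  Filter.limUnder Filter.atTop
    (fun n : ℕ => ⨆ w : Fin n → Fin m, ‖op (wordProd A (List.ofFn w))‖ ^ (1 / (n : ℝ)))

/-- The matrices share no linear subspace that is invariant and different from `0` and `ℝ^d`. -/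
def IsIrreducible {d m : ℕ} (A : Fin m → Matrix (Fin d) (Fin d) ℝ) : Prop :=
  ∀ V : Submodule ℝ (EuclideanSpace ℝ (Fin d)),
    (∀ i, ∀ x ∈ V, op (A i) x ∈ V) → V = ⊥ ∨ V = ⊤

/-- The spectral radius of a real matrix: the largest modulus of its complex eigenvalues. -/
noncomputable def specRad {d : ℕ} (M : Matrix (Fin d) (Fin d) ℝ) : ℝ :=
  (spectralRadius ℂ (M.map (algebraMap ℝ ℂ))).toReal

/-- `ν(Π) = ρ(Π)^{1/|Π|}`, where `|Π|` is the length of the product. -/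
noncomputable def nu {d m : ℕ} (A : Fin m → Matrix (Fin d) (Fin d) ℝ) (w : List (Fin m)) : ℝ :=
  specRad (wordProd A w) ^ (1 / (w.length : ℝ))

/-- The `n`-th power (repeated concatenation) of a word. -/
def wordPow {m : ℕ} (w : List (Fin m)) (n : ℕ) : List (Fin m) :=
  (List.replicate n w).flatten

/-- A nonempty word that is not a power of a shorter word. -/
def IsPrimitiveWord {m : ℕ} (w : List (Fin m)) : Prop :=
  w ≠ [] ∧ ∀ (u : List (Fin m)) (n : ℕ), u.length < w.length → w ≠ wordPow u n

/-- `P` is a set of dominant products of the family `A`; products are given by their words. -/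
structure IsDominantSet {d m : ℕ} (A : Fin m → Matrix (Fin d) (Fin d) ℝ)
    (P : Set (List (Fin m))) : Prop where
  primitive : ∀ w ∈ P, IsPrimitiveWord w
  not_cyclic : ∀ u ∈ P, ∀ v ∈ P, u ≠ v → ¬ List.IsRotated u v
  gap : ∃ q : ℝ, (∀ w ∈ P, nu A w = q) ∧
    ∃ ε : ℝ, 0 < ε ∧ ε < 1 ∧ ∀ s : List (Fin m), s ≠ [] →
      (¬ ∃ w ∈ P, ∃ v, List.IsRotated w v ∧ ∃ n : ℕ, s = wordPow v n) →
        nu A s ≤ (1 - ε) ^ (1 / (s.length : ℝ)) * q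

/-- The word `w` gives the dominant product of `A`, unique up to cyclic permutations. -/
def IsUniqueDominant {d m : ℕ} (A : Fin m → Matrix (Fin d) (Fin d) ℝ)
    (w : List (Fin m)) : Prop :=
  IsDominantSet A {w}

/-- `z` is an eigenvalue of the real matrix `M`, it is simple (a simple root of the characteristic
polynomial), and all eigenvalues other than `z` and its conjugate are strictly smaller in modulus. -/
def IsUniqueSimpleLeading {d : ℕ} (M : Matrix (Fin d) (Fin d) ℝ) (z : ℂ) : Prop :=
  (M.map (algebraMap ℝ ℂ)).charpoly.rootMultiplicity z = 1 ∧
    ∀ μ : ℂ, (M.map (algebraMap ℝ ℂ)).charpoly.IsRoot μ →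
      μ ≠ z → μ ≠ (starRingEnd ℂ) z → ‖μ‖ < ‖z‖

/-- A convex body: convex, compact, with nonempty interior, symmetric about the origin. -/
structure IsSymmConvexBody {d : ℕ} (G : Set (EuclideanSpace ℝ (Fin d))) : Prop where
  convex : Convex ℝ G
  compact : IsCompact G
  interior_nonempty : (interior G).Nonempty
  symm : ∀ x ∈ G, -x ∈ G

/-- An invariant body of the family: a convex body `G` with `co (⋃ A_i G) = ρ(A) G`. -/
def IsInvariantBody {d m : ℕ} (A : Fin m → Matrix (Fin d) (Fin d) ℝ)
    (G : Set (EuclideanSpace ℝ (Fin d))) : Prop :=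
  IsSymmConvexBody G ∧ convexHull ℝ (⋃ i, op (A i) '' G) = jsr A • G

/-- A polytope: the convex hull of finitely many points. -/
def IsPolytope {d : ℕ} (G : Set (EuclideanSpace ℝ (Fin d))) : Prop :=
  ∃ F : Finset (EuclideanSpace ℝ (Fin d)),
    G = convexHull ℝ (F : Set (EuclideanSpace ℝ (Fin d)))

/-- The ellipse spanned by `x` and `y`: the image of the unit circle under the linear map
`ℝ² → ℝ^d` taking the standard basis to `x, y` (a segment if `x, y` are linearly dependent). -/
def ellipse {d : ℕ} (x y : EuclideanSpace ℝ (Fin d)) : Set (EuclideanSpace ℝ (Fin d)) :=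
  (fun p : ℝ × ℝ => p.1 • x + p.2 • y) '' {p : ℝ × ℝ | p.1 ^ 2 + p.2 ^ 2 = 1}

/-- The convex hull of finitely many ellipses. -/
def IsHullOfEllipses {d : ℕ} (G : Set (EuclideanSpace ℝ (Fin d))) : Prop :=
  ∃ (N : ℕ) (x y : Fin N → EuclideanSpace ℝ (Fin d)),
    G = convexHull ℝ (⋃ i, ellipse (x i) (y i))

end SwitchingSystem

/-! Divide the matrices by `q = ν(Π)`. Every normalised product then has spectral radius at most 1,
and every product that is not a power of a rotation of `w` has spectral radius at most `ρ = 1 - ε`.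
Traces are therefore bounded by `d`, and an irreducible semigroup with bounded traces is bounded
(`exists_norm_opProd_le`). For `|μ| > ρ`, the determinants of `S - μ` over non-dominant products `S`
stay away from zero, so their inverses are uniformly bounded (`exists_inverse_bound`).

The normalised leading operator `T` acts on the leading subspace as `±1` or as an irrational
rotation. It preserves a compact set `E` (a pair `±v` or an ellipse) that meets every ray there, and
some power of `T` brings any point of `E` close to any other, up to sign. On the complementary
subspace the powers of `T` decay (`IsLeadingSet`).

Two facts carry the argument. A long product of non-negligible norm contains a high power of `w`
(`exists_wordPow_factor`); after that power a vector is nearly a multiple of a point of `E`. And if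
`s` is not a power of `w`, its product maps `E` to vectors whose leading component is at most `ρ`
(`proj_le`).

The closed convex hull of the orbit of `E` is an invariant body. The first fact applied to extreme
points gives uniqueness (`eq_smul_orbitHull`). Both together show that all orbit points except those
of finitely many words lie in a strictly smaller copy of the hull (`exists_finite_hull`), which
yields a polytope or a hull of ellipses. The bounds on products also give `jsr A = q`. The case `q =
0` is degenerate and forces `d = 1`. -/

namespace SwitchingSystem

open Filter Topology Set

/-! ### Powers and rotations of words. -/

section Words

variable {m : ℕ}

/-- `s` is a power of a cyclic rotation of `w`. -/
def IsRotPow (w s : List (Fin m)) : Prop :=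
  ∃ v, List.IsRotated w v ∧ ∃ n : ℕ, s = wordPow v n

@[simp]
theorem wordPow_zero (v : List (Fin m)) : wordPow v 0 = [] := by
  simp [wordPow]

theorem wordPow_add (v : List (Fin m)) (a b : ℕ) :
    wordPow v (a + b) = wordPow v a ++ wordPow v b := by
  simp only [wordPow, List.replicate_add, List.flatten_append]

@[simp]
theorem wordPow_one (v : List (Fin m)) : wordPow v 1 = v := by
  simp [wordPow]

theorem length_wordPow (v : List (Fin m)) (n : ℕ) : (wordPow v n).length = n * v.length := by
  simp [wordPow]

theorem wordPow_append_succ (x y : List (Fin m)) (n : ℕ) :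
    wordPow (x ++ y) (n + 1) = x ++ wordPow (y ++ x) n ++ y := by
  induction n with
  | zero => simp
  | succ n ih =>
    rw [wordPow_add, ih, wordPow_add (y ++ x)]
    simp

/-- Comparing the last `|w|` letters identifies the rotation with `w` itself, and cancelling copies
of `w` leaves `s` as a power of `w`. At least one appended copy is needed: `s` alone may be a power
of a proper rotation. -/
theorem not_isRotPow_append_wordPow {w s : List (Fin m)} (hw : w ≠ [])
    (hs : ∀ n, s ≠ wordPow w n) (k : ℕ) : ¬ IsRotPow w (s ++ wordPow w (k + 1)) := by
  rintro ⟨v, hv, n, h⟩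
  have hlen : v.length = w.length := hv.perm.length_eq.symm
  have hpos : 0 < w.length := List.length_pos_iff.2 hw
  rcases n with _ | n
  · simp [wordPow_add, hw] at h
  rw [wordPow_add, wordPow_add, wordPow_one, wordPow_one, ← List.append_assoc] at h
  obtain ⟨h1, rfl⟩ := List.append_inj' h hlen.symm
  have hl := congrArg List.length h1
  rw [List.length_append, length_wordPow, length_wordPow] at hl
  have hkn : k ≤ n := le_of_mul_le_mul_right (by omega) hpos
  obtain ⟨j, rfl⟩ := Nat.exists_eq_add_of_le' hkn
  rw [wordPow_add] at h1
  exact hs j (List.append_inj' h1 rfl).1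

/-- Since `(yx)^(n+1) = y (xy)^n x`, passing from a rotation back to `w` costs one period. -/
theorem IsRotPow.exists_wordPow_infix {w u : List (Fin m)} (hu : IsRotPow w u) (K : ℕ)
    (hlen : (K + 1) * w.length ≤ u.length) (hw : w ≠ []) :
    ∃ x y, u = x ++ wordPow w K ++ y := by
  obtain ⟨v, hv, n, rfl⟩ := hu
  have hpos : 0 < w.length := List.length_pos_iff.2 hw
  rw [length_wordPow, ← hv.perm.length_eq] at hlen
  have hKn : K + 1 ≤ n := le_of_mul_le_mul_right hlen hpos
  obtain ⟨j, rfl⟩ := Nat.exists_eq_add_of_le' hKn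
  obtain ⟨r, hr, rfl⟩ := List.isRotated_iff_mod.1 hv
  rw [List.rotate_eq_drop_append_take hr, ← add_assoc, wordPow_append_succ,
    List.take_append_drop, add_comm j K, wordPow_add]
  exact ⟨w.drop r, wordPow w j ++ w.take r, by simp⟩

end Words

/-! ### Convex hulls of compact sets. -/

section Compact

variable {V : Type*} [NormedAddCommGroup V] [NormedSpace ℝ V] [FiniteDimensional ℝ V]

/-- In finite dimension the convex hull of a compact set is compact. -/
theorem isCompact_convexHull {K : Set V} (hK : IsCompact K) : IsCompact (convexHull ℝ K) := by
  classical
  rcases K.eq_empty_or_nonempty with rfl | ⟨x₀, hx₀⟩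
  · simp
  set N := Module.finrank ℝ V + 1 with hN
  let f : (Fin N → ℝ) × (Fin N → V) → V := fun p => ∑ i, p.1 i • p.2 i
  have hf : Continuous f := by fun_prop
  have himg : convexHull ℝ K = f '' (stdSimplex ℝ (Fin N) ×ˢ Set.univ.pi fun _ => K) := by
    apply Subset.antisymm
    · intro x hx
      obtain ⟨ι, _, z, c, hz, hind, hc0, hc1, rfl⟩ := eq_pos_convex_span_of_mem_convexHull hx
      have hcard : Fintype.card ι ≤ Fintype.card (Fin N) := by
        rw [Fintype.card_fin]
        refine hind.card_le_finrank_succ.trans ?_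
        exact Nat.succ_le_succ (Submodule.finrank_le _)
      obtain ⟨e⟩ := Function.Embedding.nonempty_of_card_le hcard
      have hc' : ∀ j, j ∉ range e → Function.extend e c 0 j = 0 := fun j hj =>
        Function.extend_apply' _ _ _ fun ⟨i, hi⟩ => hj ⟨i, hi⟩
      have hsub : Finset.univ.map e ⊆ Finset.univ := Finset.subset_univ _
      -- Carathéodory gives at most `N` points; weight `0` at `x₀` fills the unused indices, so one
      -- compact parameter space serves all combinations.
      refine ⟨(Function.extend e c 0, Function.extend e z fun _ => x₀), ⟨⟨fun j => ?_, ?_⟩, ?_⟩, ?_⟩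
      · dsimp only
        by_cases hj : j ∈ range e
        · obtain ⟨i, rfl⟩ := hj
          rw [e.injective.extend_apply]
          exact (hc0 i).le
        · rw [hc' j hj]
      · rw [← Finset.sum_subset hsub fun j _ hj => hc' j (by simpa using hj), Finset.sum_map]
        simpa only [e.injective.extend_apply] using hc1
      · intro j _
        by_cases hj : j ∈ range e
        · obtain ⟨i, rfl⟩ := hj
          simpa only [e.injective.extend_apply] using hz ⟨i, rfl⟩
        · simpa only [Function.extend_apply' z (fun _ => x₀) j fun ⟨i, hi⟩ => hj ⟨i, hi⟩] using hx₀
      · dsimp only [f]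
        rw [← Finset.sum_subset hsub fun j _ hj => by
          rw [hc' j (by simpa using hj), zero_smul], Finset.sum_map]
        simp only [e.injective.extend_apply]
    · rintro _ ⟨⟨c, z⟩, ⟨⟨hc0, hc1⟩, hz⟩, rfl⟩
      exact (convex_convexHull ℝ K).sum_mem (fun i _ => hc0 i) hc1
        fun i _ => subset_convexHull ℝ K (hz i trivial)
  rw [himg]
  exact ((isCompact_stdSimplex ℝ (Fin N)).prod (isCompact_univ_pi fun _ => hK)).image hf

end Compact

end SwitchingSystem

/-! ### Operator products, leading sets and fixed bodies. -/

namespace SwitchingSystem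

open Filter Topology Set

section OpProd

variable {m : ℕ} {V : Type*} [NormedAddCommGroup V] [NormedSpace ℝ V]

/-- The product `B_{s_k} ⋯ B_{s_1}` of operators associated with the word `s_1 … s_k`. -/
noncomputable def opProd (B : Fin m → V →L[ℝ] V) (s : List (Fin m)) : V →L[ℝ] V :=
  ((s.map B).reverse).prod

variable (B : Fin m → V →L[ℝ] V)

@[simp]
theorem opProd_nil : opProd B [] = 1 := by
  simp [opProd]

@[simp]
theorem opProd_singleton (i : Fin m) : opProd B [i] = B i := by
  simp [opProd]

theorem opProd_append (s t : List (Fin m)) :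
    opProd B (s ++ t) = opProd B t * opProd B s := by
  simp [opProd]

theorem opProd_wordPow (v : List (Fin m)) (n : ℕ) :
    opProd B (wordPow v n) = opProd B v ^ n := by
  induction n with
  | zero => simp
  | succ n ih => rw [wordPow_add, opProd_append, wordPow_one, ih, pow_succ']

end OpProd

/-- The Euclidean space on which the matrices act. -/
abbrev Vec (d : ℕ) : Type := EuclideanSpace ℝ (Fin d)

variable {d m : ℕ}

/-- The rays of the range of `Q` are described by the compact set `E`, on which `T` acts as a
recurrent transformation, up to sign; on the kernel of `Q` the powers of `T` decay. -/
structure IsLeadingSet (T Q : Vec d →L[ℝ] Vec d) (E : Set (Vec d)) : Prop where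
  compact : IsCompact E
  nonempty : E.Nonempty
  zero_notMem : (0 : Vec d) ∉ E
  symm : ∀ x ∈ E, -x ∈ E
  image_eq : T '' E = E
  proj : ∀ x, ∃ r : ℝ, 0 ≤ r ∧ ∃ e ∈ E, Q x = r • e
  recurrent : ∀ x ∈ E, ∀ y ∈ E, ∀ δ > 0, ∀ N, ∃ k ≥ N,
    ‖(T ^ k) x - y‖ < δ ∨ ‖(T ^ k) x + y‖ < δ
  tendsto : Tendsto (fun k => T ^ k * (1 - Q)) atTop (𝓝 0)

/-- A normalised irreducible family with a unique dominant product: the products are bounded, the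
resolvents of the non-dominant products are uniformly bounded, and the set `E` describes the leading
subspace of the dominant product. -/
structure Dominance (B : Fin m → Vec d →L[ℝ] Vec d) (w : List (Fin m))
    (Q : Vec d →L[ℝ] Vec d) (E : Set (Vec d)) (C ρ : ℝ) : Prop
    extends IsLeadingSet (opProd B w) Q E where
  norm_le : ∀ s, ‖opProd B s‖ ≤ C
  irreducible : ∀ W : Submodule ℝ (Vec d), (∀ i, ∀ x ∈ W, B i x ∈ W) → W = ⊥ ∨ W = ⊤
  rho_nonneg : 0 ≤ ρ
  rho_lt_one : ρ < 1
  resolvent : ∀ μ : ℝ, ρ < |μ| → ∃ D, 0 ≤ D ∧ ∀ s, ¬ IsRotPow w s → ∃ R : Vec d →L[ℝ] Vec d,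
    ‖R‖ ≤ D ∧ R * (opProd B s - μ • 1) = 1
  word_ne : w ≠ []

/-- A convex body `G` with `co (⋃ B_i G) = G`. -/
def IsFixedBody (B : Fin m → Vec d →L[ℝ] Vec d) (G : Set (Vec d)) : Prop :=
  IsSymmConvexBody G ∧ convexHull ℝ (⋃ i, B i '' G) = G

/-- A point inside the ball is the midpoint of a nondegenerate segment in `G`. -/
theorem le_norm_of_mem_extremePoints [Nontrivial (Vec d)] {G : Set (Vec d)} {r : ℝ}
    (hball : ∀ x : Vec d, ‖x‖ < r → x ∈ G) {x : Vec d} (hx : x ∈ G.extremePoints ℝ) :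
    r ≤ ‖x‖ := by
  by_contra! hlt
  obtain ⟨e, he⟩ := exists_ne (0 : Vec d)
  have hpos : 0 < ‖e‖ := norm_pos_iff.2 he
  set t := (r - ‖x‖) / (2 * ‖e‖) with ht
  have htpos : 0 < t := by
    have : 0 < r - ‖x‖ := sub_pos.2 hlt
    positivity
  have hte : ‖t • e‖ < r - ‖x‖ := by
    rw [norm_smul, Real.norm_of_nonneg htpos.le, ht]
    have : (r - ‖x‖) / (2 * ‖e‖) * ‖e‖ = (r - ‖x‖) / 2 := by field_simp
    rw [this]
    linarith
  have h1 : x + t • e ∈ G := hball _ (by linarith [norm_add_le x (t • e)])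
  have h2 : x - t • e ∈ G := hball _ (by linarith [norm_sub_le x (t • e)])
  have hseg : x ∈ openSegment ℝ (x + t • e) (x - t • e) :=
    ⟨1 / 2, 1 / 2, by norm_num, by norm_num, by norm_num, by module⟩
  have h3 := ((mem_extremePoints.1 hx).2 _ h1 _ h2 hseg).1
  have : t • e = 0 := by simpa using h3
  exact (smul_ne_zero htpos.ne' he) this

namespace IsSymmConvexBody

variable {G : Set (Vec d)} (hG : IsSymmConvexBody G)
include hG

theorem zero_mem : (0 : Vec d) ∈ G := by
  obtain ⟨x, hx⟩ := hG.interior_nonempty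
  have hx := interior_subset hx
  have := hG.convex hx (hG.symm x hx) (a := 1 / 2) (b := 1 / 2) (by norm_num) (by norm_num)
    (by norm_num)
  simpa using this

theorem smul_mem {x : Vec d} (hx : x ∈ G) {r : ℝ} (hr0 : 0 ≤ r) (hr1 : r ≤ 1) : r • x ∈ G := by
  simpa using hG.convex hx hG.zero_mem hr0 (sub_nonneg.2 hr1) (by ring)

theorem exists_ball : ∃ r > 0, ∀ x : Vec d, ‖x‖ < r → x ∈ G := by
  obtain ⟨x₀, hx₀⟩ := hG.interior_nonempty
  obtain ⟨r, hr, hball⟩ := Metric.isOpen_iff.1 isOpen_interior x₀ hx₀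
  refine ⟨r, hr, fun x hx => ?_⟩
  have h1 : x₀ + x ∈ G := interior_subset (hball (by simpa using hx))
  have h2 : x₀ - x ∈ G := interior_subset (hball (by simpa [dist_eq_norm] using hx))
  have := hG.convex h1 (hG.symm _ h2) (a := 1 / 2) (b := 1 / 2) (by norm_num) (by norm_num)
    (by norm_num)
  convert this using 1
  module

theorem exists_bound : ∃ M > 0, ∀ x ∈ G, ‖x‖ ≤ M := by
  obtain ⟨M, hM⟩ := hG.compact.isBounded.exists_norm_le
  exact ⟨max M 1, by positivity, fun x hx => (hM x hx).trans (le_max_left _ _)⟩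

end IsSymmConvexBody

namespace IsFixedBody

variable {B : Fin m → Vec d →L[ℝ] Vec d} {G : Set (Vec d)} (hG : IsFixedBody B G)
include hG

theorem apply_mem (i : Fin m) {x : Vec d} (hx : x ∈ G) : B i x ∈ G := by
  rw [← hG.2]
  exact subset_convexHull ℝ _ (mem_iUnion.2 ⟨i, x, hx, rfl⟩)

theorem opProd_mem (s : List (Fin m)) {x : Vec d} (hx : x ∈ G) : opProd B s x ∈ G := by
  induction s using List.reverseRecOn with
  | nil => simpa using hx
  | append_singleton s i ih =>
    rw [opProd_append, opProd_singleton]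
    exact hG.apply_mem i ih

theorem subset_convexHull_length (n : ℕ) :
    G ⊆ convexHull ℝ (⋃ s ∈ {s : List (Fin m) | s.length = n}, opProd B s '' G) := by
  induction n with
  | zero =>
    intro x hx
    refine subset_convexHull ℝ _ (mem_iUnion₂.2 ⟨[], rfl, x, hx, by simp⟩)
  | succ n ih =>
    nth_rewrite 1 [← hG.2]
    refine convexHull_min (iUnion_subset fun i => ?_) (convex_convexHull ℝ _)
    refine (image_mono ih).trans ?_
    have himg := (B i).toLinearMap.image_convexHull
      (⋃ s ∈ {s : List (Fin m) | s.length = n}, opProd B s '' G)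
    rw [ContinuousLinearMap.coe_coe] at himg
    rw [himg]
    refine convexHull_mono ?_
    rintro _ ⟨_, hx, rfl⟩
    obtain ⟨s, hs, x, hxG, rfl⟩ := mem_iUnion₂.1 hx
    refine mem_iUnion₂.2 ⟨s ++ [i], by simpa using hs, x, hxG, ?_⟩
    rw [opProd_append, opProd_singleton]
    rfl

/-- Iterating the fixed-body equation writes `G` as the hull of its images under products of length
`n`, and an extreme point of a hull lies in the generating set. -/
theorem exists_of_mem_extremePoints {x : Vec d} (hx : x ∈ G.extremePoints ℝ) (n : ℕ) :
    ∃ s : List (Fin m), s.length = n ∧ ∃ y ∈ G, opProd B s y = x := by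
  have heq : G = convexHull ℝ (⋃ s ∈ {s : List (Fin m) | s.length = n}, opProd B s '' G) := by
    refine (hG.subset_convexHull_length n).antisymm (convexHull_min ?_ hG.1.convex)
    refine iUnion₂_subset fun s _ => ?_
    rintro _ ⟨y, hy, rfl⟩
    exact hG.opProd_mem s hy
  rw [heq] at hx
  obtain ⟨s, hs, y, hy, h⟩ := mem_iUnion₂.1 (extremePoints_convexHull_subset hx)
  exact ⟨s, hs, y, hy, h⟩

end IsFixedBody

/-! ### Long products and the dominant word. -/

namespace Dominance

variable {B : Fin m → Vec d →L[ℝ] Vec d} {w : List (Fin m)} {Q : Vec d →L[ℝ] Vec d}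
  {E : Set (Vec d)} {C ρ : ℝ} (h : Dominance B w Q E C ρ)
include h

theorem const_nonneg : 0 ≤ C := (norm_nonneg _).trans (h.norm_le [])

theorem nontrivial : Nontrivial (Vec d) := by
  obtain ⟨x, hx⟩ := h.nonempty
  exact ⟨x, 0, fun h0 => h.zero_notMem (h0 ▸ hx)⟩

/-- Among sufficiently many prefixes, spaced by `R` letters, two have nearly equal products. The
factor `u` between them nearly fixes the first prefix product `T`. If `u` were non-dominant, the
bounded inverse at `μ = 1` would make `T`, hence the whole product, too small. -/
theorem exists_rotPow_factor {η : ℝ} (hη : 0 < η) (R : ℕ) :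
    ∃ N : ℕ, ∀ s : List (Fin m), N ≤ s.length → η ≤ ‖opProd B s‖ →
      ∃ a u b, s = a ++ u ++ b ∧ IsRotPow w u ∧ R ≤ u.length := by
  obtain ⟨D, hD0, hD⟩ := h.resolvent 1 (by simpa using h.rho_lt_one)
  have hC := h.const_nonneg
  set δ := η / (C * D + 1) with hδ
  have hden : 0 < C * D + 1 := by positivity
  have hδpos : 0 < δ := by positivity
  have : ProperSpace (Vec d →L[ℝ] Vec d) := FiniteDimensional.proper ℝ _
  obtain ⟨t, -, htfin, hcover⟩ :=
    (isCompact_closedBall (0 : Vec d →L[ℝ] Vec d) C).finite_cover_balls (half_pos hδpos)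
  lift t to Finset (Vec d →L[ℝ] Vec d) using htfin
  refine ⟨t.card * R, fun s hs hηs => ?_⟩
  have hg : ∀ j : ℕ, ∃ y ∈ t, dist (opProd B (s.take (j * R))) y < δ / 2 := fun j => by
    have : opProd B (s.take (j * R)) ∈ Metric.closedBall (0 : Vec d →L[ℝ] Vec d) C := by
      simpa using h.norm_le _
    simpa using hcover this
  choose g hgt hgd using hg
  obtain ⟨j, j', hlt, hle, hjj⟩ : ∃ j j', j < j' ∧ j' ≤ t.card ∧ g j = g j' := by
    obtain ⟨j, hj, j', hj', hne, heq⟩ := Finset.exists_ne_map_eq_of_card_lt_of_maps_to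
      (s := Finset.range (t.card + 1)) (t := t) (by simp) (f := g) (fun j _ => hgt j)
    simp only [Finset.mem_range] at hj hj'
    rcases lt_or_gt_of_ne hne with hlt | hlt
    · exact ⟨j, j', hlt, by omega, heq⟩
    · exact ⟨j', j, hlt, by omega, heq.symm⟩
  have hj'len : j' * R ≤ s.length := (Nat.mul_le_mul_right R hle).trans hs
  set u := (s.take (j' * R)).drop (j * R) with hu
  have htake : s.take (j' * R) = s.take (j * R) ++ u := by
    have h1 : s.take (j * R) = (s.take (j' * R)).take (j * R) := by
      rw [List.take_take, min_eq_left (Nat.mul_le_mul_right R hlt.le)]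
    rw [h1, hu, List.take_append_drop]
  have hs_eq : s = s.take (j * R) ++ u ++ s.drop (j' * R) := by
    rw [← htake, List.take_append_drop]
  refine ⟨s.take (j * R), u, s.drop (j' * R), hs_eq, ?_, ?_⟩
  · by_contra hrot
    obtain ⟨X, hXn, hX⟩ := hD u hrot
    set T := opProd B (s.take (j * R)) with hT
    have hclose : ‖opProd B u * T - T‖ < δ := by
      have h1 := hgd j
      have h2 := hgd j'
      rw [hjj] at h1
      rw [htake, opProd_append] at h2
      rw [← dist_eq_norm]
      calc _ ≤ dist (opProd B u * T) (g j') + dist T (g j') := dist_triangle_right _ _ _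
        _ < δ := by linarith
    have hTX : T = X * (opProd B u * T - T) := by
      calc T = (X * (opProd B u - (1 : ℝ) • 1)) * T := by rw [hX, one_mul]
        _ = _ := by rw [mul_assoc, sub_mul, one_smul, one_mul]
    have hTn : ‖T‖ ≤ D * δ := by
      rw [hTX]
      exact (norm_mul_le _ _).trans (mul_le_mul hXn hclose.le (norm_nonneg _) hD0)
    have hsn : ‖opProd B s‖ ≤ C * ‖T‖ := by
      rw [hs_eq, List.append_assoc, opProd_append]
      exact (norm_mul_le _ _).trans (mul_le_mul_of_nonneg_right (h.norm_le _) (norm_nonneg _))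
    have h3 : η ≤ C * (D * δ) := hηs.trans (hsn.trans (mul_le_mul_of_nonneg_left hTn hC))
    have h4 : δ * (C * D + 1) = η := by rw [hδ]; field_simp
    nlinarith
  · rw [hu, List.length_drop, List.length_take, min_eq_left hj'len, ← Nat.sub_mul]
    exact Nat.le_mul_of_pos_left R (by omega)

theorem exists_wordPow_factor {η : ℝ} (hη : 0 < η) (K : ℕ) :
    ∃ N : ℕ, ∀ s : List (Fin m), N ≤ s.length → η ≤ ‖opProd B s‖ →
      ∃ a b, s = a ++ wordPow w K ++ b := by
  obtain ⟨N, hN⟩ := h.exists_rotPow_factor hη ((K + 1) * w.length)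
  refine ⟨N, fun s hs hηs => ?_⟩
  obtain ⟨a, u, b, rfl, hu, hlen⟩ := hN s hs hηs
  obtain ⟨x, y, rfl⟩ := hu.exists_wordPow_infix K hlen h.word_ne
  exact ⟨a ++ x, y ++ b, by simp⟩

theorem pow_mem (k : ℕ) {x : Vec d} (hx : x ∈ E) : (opProd B w ^ k) x ∈ E := by
  induction k with
  | zero => simpa using hx
  | succ k ih =>
    rw [pow_succ', ← h.image_eq]
    exact ⟨_, ih, rfl⟩

theorem exists_pow_close {δ : ℝ} (hδ : 0 < δ) : ∃ k₀, ∀ k ≥ k₀, ∀ (y e : Vec d) (r : ℝ),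
    Q y = r • e → ‖(opProd B w ^ k) y - r • (opProd B w ^ k) e‖ ≤ δ * ‖y‖ := by
  obtain ⟨k₀, hk₀⟩ := (Metric.tendsto_atTop.1 h.tendsto) δ hδ
  refine ⟨k₀, fun k hk y e r hy => ?_⟩
  have h1 : (opProd B w ^ k) y - r • (opProd B w ^ k) e = (opProd B w ^ k * (1 - Q)) y := by
    rw [← map_smul, ← hy, ← map_sub]
    rfl
  rw [h1]
  have := hk₀ k hk
  rw [dist_zero_right] at this
  exact (ContinuousLinearMap.le_opNorm _ _).trans
    (mul_le_mul_of_nonneg_right this.le (norm_nonneg _))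

/-- By recurrence, appending many copies of `w` to `s` returns `x` approximately to `±r • x`. So `x`
is an approximate eigenvector of non-dominant products for `r` or `-r`, which the uniform inverse
bound excludes when `r > ρ`. -/
theorem proj_le {s : List (Fin m)} (hs : ∀ n, s ≠ wordPow w n) {x e : Vec d} (hx : x ∈ E)
    (he : e ∈ E) {r : ℝ} (hr : 0 ≤ r) (hQ : Q (opProd B s x) = r • e) : r ≤ ρ := by
  by_contra! hlt
  obtain ⟨D₁, hD₁0, hD₁⟩ := h.resolvent r (by rwa [abs_of_nonneg hr])
  obtain ⟨D₂, hD₂0, hD₂⟩ := h.resolvent (-r) (by rwa [abs_neg, abs_of_nonneg hr])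
  have hx0 : 0 < ‖x‖ := norm_pos_iff.2 fun h0 => h.zero_notMem (h0 ▸ hx)
  set y := opProd B s x with hy
  set δ := ‖x‖ / ((D₁ + D₂ + 1) * (‖y‖ + r + 1)) with hδ
  have hδpos : 0 < δ := by positivity
  obtain ⟨k₀, hk₀⟩ := h.exists_pow_close hδpos
  -- The extra `1` makes the exponent positive, as `not_isRotPow_append_wordPow` requires.
  obtain ⟨k, hk, hclose⟩ := h.recurrent e he x hx δ hδpos (k₀ + 1)
  obtain ⟨k, rfl⟩ : ∃ k', k = k' + 1 := ⟨k - 1, by omega⟩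
  have hrot := not_isRotPow_append_wordPow h.word_ne hs k
  have h1 := hk₀ (k + 1) (by omega) y e r hQ
  have hprod : opProd B (s ++ wordPow w (k + 1)) x = (opProd B w ^ (k + 1)) y := by
    rw [opProd_append, opProd_wordPow]
    rfl
  have key : ∀ (μ D : ℝ) (X : Vec d →L[ℝ] Vec d), 0 ≤ D → D ≤ D₁ + D₂ → ‖X‖ ≤ D →
      X * (opProd B (s ++ wordPow w (k + 1)) - μ • 1) = 1 →
      ‖r • (opProd B w ^ (k + 1)) e - μ • x‖ ≤ r * δ → False := by
    intro μ D X hD0 hD hXn hX hμ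
    have h2 : ‖(opProd B w ^ (k + 1)) y - μ • x‖ ≤ δ * (‖y‖ + r) := by
      calc _ ≤ ‖(opProd B w ^ (k + 1)) y - r • (opProd B w ^ (k + 1)) e‖ +
            ‖r • (opProd B w ^ (k + 1)) e - μ • x‖ := norm_sub_le_norm_sub_add_norm_sub _ _ _
        _ ≤ _ := by linarith
    have h3 : x = X ((opProd B w ^ (k + 1)) y - μ • x) := by
      calc x = (X * (opProd B (s ++ wordPow w (k + 1)) - μ • 1)) x := by rw [hX]; rfl
        _ = X (opProd B (s ++ wordPow w (k + 1)) x - μ • x) := rfl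
        _ = _ := by rw [hprod]
    have h4 : ‖x‖ ≤ (D₁ + D₂) * (δ * (‖y‖ + r)) := by
      calc ‖x‖ = ‖X ((opProd B w ^ (k + 1)) y - μ • x)‖ := congrArg _ h3
        _ ≤ ‖X‖ * ‖(opProd B w ^ (k + 1)) y - μ • x‖ := X.le_opNorm _
        _ ≤ _ := mul_le_mul (hXn.trans hD) h2 (norm_nonneg _) (by positivity)
    have h5 : δ * ((D₁ + D₂ + 1) * (‖y‖ + r + 1)) = ‖x‖ := by rw [hδ]; field_simp
    have h6 : 0 < δ * (D₁ + D₂ + ‖y‖ + r + 1) := by positivity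
    nlinarith
  rcases hclose with hc | hc
  · obtain ⟨X, hXn, hX⟩ := hD₁ _ hrot
    refine key r D₁ X hD₁0 (by linarith) hXn hX ?_
    rw [← smul_sub, norm_smul, Real.norm_of_nonneg hr]
    exact mul_le_mul_of_nonneg_left hc.le hr
  · obtain ⟨X, hXn, hX⟩ := hD₂ _ hrot
    refine key (-r) D₂ X hD₂0 (by linarith) hXn hX ?_
    rw [neg_smul, sub_neg_eq_add, ← smul_add, norm_smul, Real.norm_of_nonneg hr]
    exact mul_le_mul_of_nonneg_left hc.le hr

end Dominance

end SwitchingSystem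

/-! ### The orbit hull: invariance, uniqueness, finite generation. -/

namespace SwitchingSystem

open Filter Topology Set

variable {d m : ℕ}

/-- The closed convex hull of the orbit of `E` under all products. -/
def orbitHull (B : Fin m → Vec d →L[ℝ] Vec d) (E : Set (Vec d)) : Set (Vec d) :=
  closure (convexHull ℝ (⋃ s : List (Fin m), opProd B s '' E))

section OrbitHull

variable {B : Fin m → Vec d →L[ℝ] Vec d} {E : Set (Vec d)}

theorem opProd_mem_orbitHull (s : List (Fin m)) {x : Vec d} (hx : x ∈ E) :
    opProd B s x ∈ orbitHull B E :=
  subset_closure (subset_convexHull ℝ _ (mem_iUnion.2 ⟨s, x, hx, rfl⟩))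

theorem orbitHull_subset {K : Set (Vec d)} (hconv : Convex ℝ K) (hclosed : IsClosed K)
    (hK : ∀ s, ∀ x ∈ E, opProd B s x ∈ K) : orbitHull B E ⊆ K := by
  refine closure_minimal (convexHull_min (iUnion_subset fun s => ?_) hconv) hclosed
  rintro _ ⟨x, hx, rfl⟩
  exact hK s x hx

theorem convex_orbitHull : Convex ℝ (orbitHull B E) :=
  (convex_convexHull ℝ _).closure

theorem isClosed_orbitHull : IsClosed (orbitHull B E) := isClosed_closure

theorem mem_orbitHull {x : Vec d} (hx : x ∈ E) : x ∈ orbitHull B E := by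
  simpa using opProd_mem_orbitHull (B := B) [] hx

theorem apply_mem_orbitHull (i : Fin m) {x : Vec d} (hx : x ∈ orbitHull B E) :
    B i x ∈ orbitHull B E := by
  have : orbitHull B E ⊆ B i ⁻¹' orbitHull B E := by
    refine orbitHull_subset ?_ (isClosed_orbitHull.preimage (B i).continuous) fun s y hy => ?_
    · exact convex_orbitHull.is_linear_preimage (B i).toLinearMap.isLinear
    · have := opProd_mem_orbitHull (B := B) (s ++ [i]) hy
      rwa [opProd_append, opProd_singleton] at this
  exact this hx

end OrbitHull

namespace Dominance

variable {B : Fin m → Vec d →L[ℝ] Vec d} {w : List (Fin m)} {Q : Vec d →L[ℝ] Vec d}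
  {E : Set (Vec d)} {C ρ : ℝ} (h : Dominance B w Q E C ρ)
include h

theorem exists_norm_bound : ∃ M > 0, ∀ s, ∀ x ∈ E, ‖opProd B s x‖ ≤ M := by
  obtain ⟨M, hM⟩ := h.compact.isBounded.exists_norm_le
  refine ⟨max (C * M) 1, by positivity, fun s x hx => ?_⟩
  exact ((opProd B s).le_opNorm x).trans ((mul_le_mul (h.norm_le s) (hM x hx) (norm_nonneg _)
    h.const_nonneg).trans (le_max_left _ _))

theorem isCompact_orbitHull : IsCompact (orbitHull B E) := by
  obtain ⟨M, -, hM⟩ := h.exists_norm_bound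
  refine (isCompact_closedBall (0 : Vec d) M).of_isClosed_subset isClosed_orbitHull ?_
  refine orbitHull_subset (convex_closedBall _ _) Metric.isClosed_closedBall fun s x hx => ?_
  simpa using hM s x hx

theorem neg_mem_orbitHull {x : Vec d} (hx : x ∈ orbitHull B E) : -x ∈ orbitHull B E := by
  have : orbitHull B E ⊆ -orbitHull B E := by
    refine orbitHull_subset convex_orbitHull.neg isClosed_orbitHull.neg fun s y hy => ?_
    rw [Set.mem_neg, ← map_neg]
    exact opProd_mem_orbitHull s (h.symm y hy)
  exact this hx

theorem orbitHull_nonempty : (orbitHull B E).Nonempty := by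
  obtain ⟨x, hx⟩ := h.nonempty
  exact ⟨x, mem_orbitHull hx⟩

theorem isSymmConvexBody_orbitHull : IsSymmConvexBody (orbitHull B E) := by
  refine ⟨convex_orbitHull, h.isCompact_orbitHull, ?_, fun x hx => h.neg_mem_orbitHull hx⟩
  have h0 : (0 : Vec d) ∈ orbitHull B E := by
    obtain ⟨x, hx⟩ := h.orbitHull_nonempty
    simpa using convex_orbitHull hx (h.neg_mem_orbitHull hx) (a := 1 / 2) (b := 1 / 2)
      (by norm_num) (by norm_num) (by norm_num)
  rw [convex_orbitHull.interior_nonempty_iff_affineSpan_eq_top]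
  -- The span is invariant and contains the nonzero points of `E`, so irreducibility makes it the
  -- whole space; this gives nonempty interior.
  have hspan : Submodule.span ℝ (orbitHull B E) = ⊤ := by
    refine (h.irreducible _ fun i x hx => ?_).resolve_left fun hbot => ?_
    · have hle : Submodule.span ℝ (orbitHull B E) ≤
          (Submodule.span ℝ (orbitHull B E)).comap (B i).toLinearMap :=
        Submodule.span_le.2 fun y hy => Submodule.subset_span (apply_mem_orbitHull i hy)
      exact hle hx
    · obtain ⟨x, hx⟩ := h.nonempty
      have hx' : x ∈ Submodule.span ℝ (orbitHull B E) :=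
        Submodule.subset_span (mem_orbitHull hx)
      rw [hbot, Submodule.mem_bot] at hx'
      exact h.zero_notMem (hx' ▸ hx)
  rw [← insert_eq_of_mem h0]
  refine SetLike.coe_injective ?_
  rw [affineSpan_insert_zero, hspan]
  rfl

/-- The inclusion that needs an argument uses `T '' E = E`: prefixing `w` makes every orbit point
the image of a nonempty word, so it lies in some `B i '' orbitHull B E`. -/
theorem isFixedBody_orbitHull : IsFixedBody B (orbitHull B E) := by
  refine ⟨h.isSymmConvexBody_orbitHull, Subset.antisymm ?_ ?_⟩
  · refine convexHull_min (iUnion_subset fun i => ?_) convex_orbitHull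
    rintro _ ⟨x, hx, rfl⟩
    exact apply_mem_orbitHull i hx
  · have hcomp : IsCompact (convexHull ℝ (⋃ i, B i '' orbitHull B E)) :=
      isCompact_convexHull (isCompact_iUnion fun i => h.isCompact_orbitHull.image (B i).continuous)
    have key : ∀ s : List (Fin m), s ≠ [] → ∀ x ∈ E,
        opProd B s x ∈ convexHull ℝ (⋃ i, B i '' orbitHull B E) := by
      intro s hs x hx
      obtain ⟨s, i, rfl⟩ := List.eq_nil_or_concat' s |>.resolve_left hs
      refine subset_convexHull ℝ _ (mem_iUnion.2 ⟨i, _, opProd_mem_orbitHull s hx, ?_⟩)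
      rw [opProd_append, opProd_singleton]
      rfl
    refine orbitHull_subset (convex_convexHull ℝ _) hcomp.isClosed fun s x hx => ?_
    rw [← h.image_eq] at hx
    obtain ⟨y, hy, rfl⟩ := hx
    have := key (w ++ s) (by simp [h.word_ne]) y hy
    rwa [opProd_append] at this

/-- The largest multiple of `E` that fits into a fixed body bounds all projections of the body. -/
theorem exists_scale {G : Set (Vec d)} (hG : IsFixedBody B G) :
    ∃ c > 0, (∀ e ∈ E, c • e ∈ G) ∧
      ∀ y ∈ G, ∀ e ∈ E, ∀ r : ℝ, 0 ≤ r → Q y = r • e → r ≤ c := by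
  obtain ⟨r₀, hr₀, hball⟩ := hG.1.exists_ball
  obtain ⟨M, hM0, hM⟩ := hG.1.exists_bound
  obtain ⟨N, hN0, hN⟩ := h.exists_norm_bound
  obtain ⟨e₀, he₀⟩ := h.nonempty
  have he₀pos : 0 < ‖e₀‖ := norm_pos_iff.2 fun h0 => h.zero_notMem (h0 ▸ he₀)
  set S : Set ℝ := {r | ∀ e ∈ E, r • e ∈ G} with hS
  have hSclosed : IsClosed S := by
    have : S = ⋂ e ∈ E, (fun r : ℝ => r • e) ⁻¹' G := by ext; simp [hS]
    rw [this]
    exact isClosed_biInter fun e _ => hG.1.compact.isClosed.preimage (by fun_prop)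
  have hbdd : BddAbove S := by
    refine ⟨M / ‖e₀‖, fun r hr => ?_⟩
    rw [le_div_iff₀ he₀pos]
    calc r * ‖e₀‖ ≤ ‖r • e₀‖ := by
          rw [norm_smul]
          exact mul_le_mul_of_nonneg_right (le_abs_self r) (norm_nonneg _)
      _ ≤ M := hM _ (hr e₀ he₀)
  have hmem : r₀ / (2 * N) ∈ S := fun e he => by
    refine hball _ ?_
    have heN : ‖e‖ ≤ N := by simpa using hN [] e he
    rw [norm_smul, Real.norm_of_nonneg (by positivity)]
    calc r₀ / (2 * N) * ‖e‖ ≤ r₀ / (2 * N) * N := by gcongr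
      _ = r₀ / 2 := by field_simp
      _ < r₀ := half_lt_self hr₀
  refine ⟨sSup S, lt_of_lt_of_le (by positivity) (le_csSup hbdd hmem),
    -- If `Q y = r • e`, then `T ^ k y` stays in `G`, approaches `r • T ^ k e`, and by recurrence
    -- comes close to `±r • x` for any `x ∈ E`. As `G` is closed and symmetric, `r` belongs to `S`.
    hSclosed.csSup_mem ⟨_, hmem⟩ hbdd, fun y hy e he r hr hQ => le_csSup hbdd fun x hx => ?_⟩
  rw [← hG.1.compact.isClosed.closure_eq, Metric.mem_closure_iff]
  intro δ hδ
  have hδ' : 0 < δ / (‖y‖ + r + 1) := by positivity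
  obtain ⟨k₀, hk₀⟩ := h.exists_pow_close hδ'
  obtain ⟨k, hk, hclose⟩ := h.recurrent e he x hx _ hδ' k₀
  have h1 := hk₀ k hk y e r hQ
  have hyk : (opProd B w ^ k) y ∈ G := by
    rw [← opProd_wordPow]
    exact hG.opProd_mem _ hy
  have h5 : δ / (‖y‖ + r + 1) * (‖y‖ + r + 1) = δ := by field_simp
  rcases hclose with hc | hc
  · refine ⟨_, hyk, ?_⟩
    rw [dist_comm, dist_eq_norm]
    have h2 : ‖r • (opProd B w ^ k) e - r • x‖ ≤ r * (δ / (‖y‖ + r + 1)) := by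
      rw [← smul_sub, norm_smul, Real.norm_of_nonneg hr]
      exact mul_le_mul_of_nonneg_left hc.le hr
    calc _ ≤ _ := norm_sub_le_norm_sub_add_norm_sub _ (r • (opProd B w ^ k) e) _
      _ ≤ δ / (‖y‖ + r + 1) * ‖y‖ + r * (δ / (‖y‖ + r + 1)) := add_le_add h1 h2
      _ < δ := by nlinarith
  · refine ⟨_, hG.1.symm _ hyk, ?_⟩
    rw [dist_eq_norm, sub_neg_eq_add, add_comm]
    have h2 : ‖r • (opProd B w ^ k) e - -(r • x)‖ ≤ r * (δ / (‖y‖ + r + 1)) := by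
      rw [sub_neg_eq_add, ← smul_add, norm_smul, Real.norm_of_nonneg hr]
      exact mul_le_mul_of_nonneg_left hc.le hr
    rw [← sub_neg_eq_add]
    calc _ ≤ _ := norm_sub_le_norm_sub_add_norm_sub _ (r • (opProd B w ^ k) e) _
      _ ≤ δ / (‖y‖ + r + 1) * ‖y‖ + r * (δ / (‖y‖ + r + 1)) := add_le_add h1 h2
      _ < δ := by nlinarith

/-- An extreme point of `G` is the image of a point of `G` under an arbitrarily long product, whose
norm is bounded below. That product contains a high power of `w`, which pushes the point close to `r
• E` with `r ≤ c`. Hence extreme points are limits of points of `c • orbitHull B E`, and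
Krein–Milman finishes. -/
theorem eq_smul_orbitHull {G : Set (Vec d)} (hG : IsFixedBody B G) :
    ∃ c : ℝ, 0 < c ∧ G = c • orbitHull B E := by
  have := h.nontrivial
  obtain ⟨c, hc, hcE, hcQ⟩ := h.exists_scale hG
  obtain ⟨r₀, hr₀, hball⟩ := hG.1.exists_ball
  obtain ⟨M, hM0, hM⟩ := hG.1.exists_bound
  have hC := h.const_nonneg
  have hO := h.isSymmConvexBody_orbitHull
  refine ⟨c, hc, Subset.antisymm ?_ ?_⟩
  · have hclosed : IsClosed (c • orbitHull B E) := isClosed_orbitHull.smul_of_ne_zero hc.ne'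
    rw [← closure_convexHull_extremePoints hG.1.compact hG.1.convex]
    refine closure_minimal (convexHull_min (fun x hx => ?_) (convex_orbitHull.smul c)) hclosed
    rw [← hclosed.closure_eq, Metric.mem_closure_iff]
    intro δ hδ
    have hδ' : 0 < δ / (C * M + 1) := by positivity
    obtain ⟨K, hK⟩ := h.exists_pow_close hδ'
    obtain ⟨N, hN⟩ := h.exists_wordPow_factor (η := r₀ / M) (by positivity) K
    obtain ⟨s, hs, y, hy, hsy⟩ := hG.exists_of_mem_extremePoints hx N
    have hη : r₀ / M ≤ ‖opProd B s‖ := by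
      rw [div_le_iff₀ hM0]
      calc r₀ ≤ ‖x‖ := le_norm_of_mem_extremePoints hball hx
        _ ≤ ‖opProd B s‖ * ‖y‖ := hsy ▸ (opProd B s).le_opNorm y
        _ ≤ _ := mul_le_mul_of_nonneg_left (hM y hy) (norm_nonneg _)
    obtain ⟨a, b, rfl⟩ := hN s hs.ge hη
    set y' := opProd B a y with hy'
    have hy'G : y' ∈ G := hG.opProd_mem a hy
    obtain ⟨r, hr, e, he, hQ⟩ := h.proj y'
    have hx_eq : x = opProd B b ((opProd B w ^ K) y') := by
      rw [← hsy, opProd_append, opProd_append, opProd_wordPow]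
      rfl
    refine ⟨opProd B b (r • (opProd B w ^ K) e), ?_, ?_⟩
    · have hmem := hO.smul_mem (opProd_mem_orbitHull b (h.pow_mem K he)) (div_nonneg hr hc.le)
        ((div_le_one hc).2 (hcQ y' hy'G e he r hr hQ))
      refine ⟨_, hmem, ?_⟩
      simp only [smul_smul, map_smul, mul_div_cancel₀ r hc.ne']
    · rw [hx_eq, dist_eq_norm, ← map_sub]
      have h1 := hK K le_rfl y' e r hQ
      have h5 : δ / (C * M + 1) * (C * M + 1) = δ := by field_simp
      calc _ ≤ ‖opProd B b‖ * _ := (opProd B b).le_opNorm _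
        _ ≤ C * (δ / (C * M + 1) * M) := mul_le_mul (h.norm_le b)
            (h1.trans (mul_le_mul_of_nonneg_left (hM _ hy'G) hδ'.le)) (norm_nonneg _) hC
        _ < δ := by nlinarith
  · rintro _ ⟨x, hx, rfl⟩
    have hsub : orbitHull B E ⊆ (c • LinearMap.id : Vec d →ₗ[ℝ] Vec d) ⁻¹' G := by
      refine orbitHull_subset (hG.1.convex.linear_preimage _) ?_ fun s e he => ?_
      · exact hG.1.compact.isClosed.preimage (LinearMap.continuous_of_finiteDimensional _)
      · have := hG.opProd_mem s (hcE e he)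
        rwa [map_smul] at this
    exact hsub hx

/-- Orbit points of long words either reduce to shorter words or lie in `θ • orbitHull B E` with `θ
< 1`. The latter contains no extreme point, so the hull is generated by short words. -/
theorem exists_finite_hull : ∃ F : Set (List (Fin m)), F.Finite ∧
    orbitHull B E = convexHull ℝ (⋃ p ∈ F, opProd B p '' E) := by
  have := h.nontrivial
  have hO := h.isSymmConvexBody_orbitHull
  have hfix := h.isFixedBody_orbitHull
  obtain ⟨r₀, hr₀, hball⟩ := hO.exists_ball
  obtain ⟨M, hM0, hM⟩ := h.exists_norm_bound
  have hwpos : 0 < w.length := List.length_pos_iff.2 h.word_ne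
  have hρ0 := h.rho_nonneg
  have hρ1 := h.rho_lt_one
  -- `θ = ρ + (1 - ρ) / 2`: the leading component uses at most `ρ`, and `(1 - ρ) / 2` is left for
  -- the decaying remainder.
  set θ := (1 + ρ) / 2 with hθ
  have hθ0 : 0 < θ := by positivity
  have hθ1 : θ < 1 := by rw [hθ]; linarith
  have hsmall : ∀ (t : ℝ), 0 < t → ∀ x : Vec d, ‖x‖ < t * r₀ → ∃ y ∈ orbitHull B E, x = t • y := by
    intro t ht x hx
    refine ⟨t⁻¹ • x, hball _ ?_, by rw [smul_inv_smul₀ ht.ne']⟩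
    rwa [norm_smul, norm_inv, Real.norm_of_nonneg ht.le, inv_mul_lt_iff₀ ht]
  have hδ : 0 < (1 - ρ) / 2 * r₀ / (2 * M) := by
    have : 0 < 1 - ρ := sub_pos.2 hρ1
    positivity
  obtain ⟨K, hK⟩ := h.exists_pow_close hδ
  -- Below this threshold a product sends `E` into the ball of radius `θ * r₀`, hence into `θ •
  -- orbitHull B E`. The power `K + 1` is positive, so deleting it shortens the word in the
  -- induction.
  obtain ⟨N, hN⟩ := h.exists_wordPow_factor (η := θ * r₀ / (2 * M)) (by positivity) (K + 1)
  have key : ∀ n (t : List (Fin m)), t.length = n → ∀ x ∈ E, opProd B t x ∈ θ • orbitHull B E ∨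
      ∃ p : List (Fin m), p.length < N ∧ ∃ x' ∈ E, opProd B p x' = opProd B t x := by
    intro n
    induction n using Nat.strong_induction_on with
    | _ n ih =>
      intro t ht x hx
      by_cases htN : t.length < N
      · exact Or.inr ⟨t, htN, x, hx, rfl⟩
      push Not at htN
      by_cases hη : θ * r₀ / (2 * M) ≤ ‖opProd B t‖
      · obtain ⟨a, b, rfl⟩ := hN t htN hη
        have hprod : opProd B (a ++ wordPow w (K + 1) ++ b) x =
            opProd B b ((opProd B w ^ (K + 1)) (opProd B a x)) := by
          rw [opProd_append, opProd_append, opProd_wordPow]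
          rfl
        rw [hprod]
        -- If the prefix before `w ^ (K + 1)` is a power of `w`, both together only move `x` within
        -- `E` and can be dropped. Otherwise `proj_le` contracts the leading component.
        by_cases ha : ∃ j, a = wordPow w j
        · obtain ⟨j, rfl⟩ := ha
          have hx' : (opProd B w ^ (K + 1)) (opProd B (wordPow w j) x) ∈ E := by
            rw [opProd_wordPow]
            exact h.pow_mem _ (h.pow_mem _ hx)
          refine ih b.length ?_ b rfl _ hx'
          rw [← ht]
          simp only [List.length_append, length_wordPow]
          have : 0 < (K + 1) * w.length := by positivity
          omega
        · push Not at ha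
          left
          obtain ⟨r, hr, e, he, hQ⟩ := h.proj (opProd B a x)
          have hrρ := h.proj_le ha hx he hr hQ
          have h1 := hK (K + 1) (by omega) _ e r hQ
          set z := (opProd B w ^ (K + 1)) (opProd B a x) with hz
          set z' := (opProd B w ^ (K + 1)) e with hz'
          have h2 : ‖z - r • z'‖ < (1 - ρ) / 2 * r₀ := by
            have h3 : (1 - ρ) / 2 * r₀ / (2 * M) * M = (1 - ρ) / 2 * r₀ / 2 := by field_simp
            have h4 : 0 < (1 - ρ) / 2 * r₀ := by
              have : 0 < 1 - ρ := sub_pos.2 hρ1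
              positivity
            have h5 := mul_le_mul_of_nonneg_left (hM a x hx) hδ.le
            linarith
          obtain ⟨y, hy, hzy⟩ := hsmall _ (by linarith) _ h2
          have hz'O : z' ∈ orbitHull B E := mem_orbitHull (h.pow_mem (K + 1) he)
          have hzO : θ⁻¹ • z ∈ orbitHull B E := by
            set σ := r + (1 - ρ) / 2 with hσ
            have hσ0 : 0 < σ := by linarith
            have h6 := convex_orbitHull hz'O hy (a := r / σ) (b := (1 - ρ) / 2 / σ)
              (by positivity) (div_nonneg (by linarith) hσ0.le) (by rw [← add_div, div_self hσ0.ne'])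
            have h7 := hO.smul_mem h6 (r := σ / θ) (by positivity)
              ((div_le_one hθ0).2 (by linarith))
            convert h7 using 1
            have h8 : z = r • z' + ((1 - ρ) / 2) • y := by rw [← hzy]; abel
            rw [h8, smul_add, smul_add, smul_smul, smul_smul, smul_smul, smul_smul]
            congr 2 <;> field_simp
          refine ⟨opProd B b (θ⁻¹ • z), hfix.opProd_mem b hzO, ?_⟩
          simp only [map_smul, smul_inv_smul₀ hθ0.ne']
      · left
        push Not at hη
        have h1 : ‖opProd B t x‖ < θ * r₀ := by
          have h3 : θ * r₀ / (2 * M) * M = θ * r₀ / 2 := by field_simp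
          have h4 : 0 < θ * r₀ := by positivity
          have hxM : ‖x‖ ≤ M := by simpa using hM [] x hx
          calc _ ≤ ‖opProd B t‖ * ‖x‖ := (opProd B t).le_opNorm x
            _ ≤ θ * r₀ / (2 * M) * M := mul_le_mul hη.le hxM (norm_nonneg _) (by positivity)
            _ < θ * r₀ := by linarith
        obtain ⟨y, hy, hxy⟩ := hsmall θ hθ0 _ h1
        exact ⟨y, hy, hxy.symm⟩
  have hFfin : {p : List (Fin m) | p.length < N}.Finite := List.finite_length_lt _ _
  set H := ⋃ p ∈ {p : List (Fin m) | p.length < N}, opProd B p '' E with hH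
  have hHcomp : IsCompact H :=
    hFfin.isCompact_biUnion fun p _ => h.compact.image (opProd B p).continuous
  have hHO : H ⊆ orbitHull B E := iUnion₂_subset fun p _ => by
    rintro _ ⟨x, hx, rfl⟩
    exact opProd_mem_orbitHull p hx
  refine ⟨_, hFfin, Subset.antisymm ?_ (convexHull_min hHO convex_orbitHull)⟩
  have heq : orbitHull B E = convexHull ℝ (H ∪ θ • orbitHull B E) := by
    refine Subset.antisymm ?_ (convexHull_min (union_subset hHO ?_) convex_orbitHull)
    · refine orbitHull_subset (convex_convexHull ℝ _) ?_ fun t x hx => subset_convexHull ℝ _ ?_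
      · exact (isCompact_convexHull
          (hHcomp.union (h.isCompact_orbitHull.smul θ))).isClosed
      · rcases key _ t rfl x hx with h1 | ⟨p, hp, x', hx', h1⟩
        · exact Or.inr h1
        · exact Or.inl (mem_biUnion hp ⟨x', hx', h1⟩)
    · rintro _ ⟨x, hx, rfl⟩
      exact hO.smul_mem hx hθ0.le hθ1.le
  rw [← closure_convexHull_extremePoints h.isCompact_orbitHull convex_orbitHull]
  refine closure_minimal (convexHull_mono fun x hx => ?_) (isCompact_convexHull hHcomp).isClosed
  have hx' := hx
  rw [heq] at hx'
  -- An extreme point `θ • y` lies strictly between `y` and `0`, so it would be `0`, yet extreme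
  -- points have norm at least `r₀`.
  rcases extremePoints_convexHull_subset hx' with h1 | ⟨y, hy, rfl⟩
  · exact h1
  · exfalso
    have hseg : θ • y ∈ openSegment ℝ y 0 :=
      ⟨θ, 1 - θ, hθ0, sub_pos.2 hθ1, by ring, by simp⟩
    have h0 := ((mem_extremePoints.1 hx).2 _ hy _ hO.zero_mem hseg).2
    have := le_norm_of_mem_extremePoints hball hx
    simp only [← h0, norm_zero] at this
    linarith

end Dominance

end SwitchingSystem

/-! ### Boundedness of irreducible semigroups from bounded traces. -/

namespace SwitchingSystem

open Filter Topology Set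

section TraceForm

open Polynomial

variable {V : Type*} [AddCommGroup V] [Module ℝ V] [FiniteDimensional ℝ V]

omit [FiniteDimensional ℝ V] in
theorem trace_aeval_eq_zero {f : Module.End ℝ V} (hf : ∀ k, LinearMap.trace ℝ V (f ^ (k + 1)) = 0)
    (p : ℝ[X]) : LinearMap.trace ℝ V (aeval f (p * X)) = 0 := by
  induction p using Polynomial.induction_on' with
  | add p q hp hq => rw [add_mul, map_add, map_add, hp, hq, add_zero]
  | monomial n a => rw [monomial_mul_X, aeval_monomial, ← Algebra.smul_def, map_smul, hf, smul_zero]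

/-- An operator all of whose positive powers have trace zero has no nonzero fixed vector. -/
theorem eq_zero_of_trace_pow_eq_zero {f : Module.End ℝ V}
    (hf : ∀ k, LinearMap.trace ℝ V (f ^ (k + 1)) = 0) {v : V} (hv : f v = v) : v = 0 := by
  by_contra hv0
  have heig : f.HasEigenvector 1 v := ⟨by simp [hv], hv0⟩
  obtain ⟨a, h, hχ, hdvd⟩ : ∃ a h, f.charpoly = X ^ a * h ∧ ¬ X ∣ h := by
    obtain ⟨h, h1, h2⟩ := exists_eq_pow_rootMultiplicity_mul_and_not_dvd f.charpoly
      (LinearMap.charpoly_monic f).ne_zero 0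
    rw [C_0, sub_zero] at h1 h2
    exact ⟨_, h, h1, h2⟩
  -- With `a + 1` in place of `a`, `p = u * X ^ (a + 1)` is a multiple of `X` even when `a = 0`, so
  -- `p(f)` has trace zero. It is the projection onto the part where `f` is invertible; an
  -- idempotent of trace zero vanishes, yet `p` takes the value 1 at the eigenvalue 1.
  obtain ⟨u, t, hut⟩ : IsCoprime (X ^ (a + 1)) h :=
    (irreducible_X.coprime_iff_not_dvd.2 hdvd).pow_left
  have h1 : h.eval 1 = 0 := by
    have h2 := Module.End.aeval_apply_of_hasEigenvector (p := f.charpoly) heig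
    rw [LinearMap.aeval_self_charpoly, LinearMap.zero_apply, eq_comm, smul_eq_zero_iff_left hv0,
      hχ] at h2
    simpa using h2
  obtain ⟨p, hp⟩ : ∃ p : ℝ[X], p = u * X ^ (a + 1) := ⟨_, rfl⟩
  rw [← hp] at hut
  have hidem : IsIdempotentElem (aeval f p) := by
    have h3 : p - p * p = (u * X * t) * f.charpoly := by
      rw [hχ]
      calc p - p * p = p * (1 - p) := by ring
        _ = p * (t * h) := by rw [← hut]; ring
        _ = _ := by rw [hp]; ring
    have h4 : aeval f (p - p * p) = 0 := by
      rw [h3, map_mul, LinearMap.aeval_self_charpoly, mul_zero]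
    rw [map_sub, map_mul, sub_eq_zero] at h4
    exact h4.symm
  have htr : LinearMap.trace ℝ V (aeval f p) = 0 := by
    rw [hp, pow_succ, ← mul_assoc]
    exact trace_aeval_eq_zero hf _
  have hzero := (LinearMap.IsIdempotentElem.trace_eq_zero_iff hidem).1 htr
  have h5 := Module.End.aeval_apply_of_hasEigenvector (p := p) heig
  have h6 : p.eval 1 = 1 := by
    have := congrArg (eval 1) hut
    rwa [eval_add, eval_mul, h1, mul_zero, add_zero, eval_one] at this
  rw [hzero, h6, one_smul] at h5
  exact hv0 h5.symm

end TraceForm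

section Bounded

variable {d m : ℕ} (B : Fin m → Vec d →L[ℝ] Vec d)

theorem smul_mul_clm (a : ℝ) (S T : Vec d →L[ℝ] Vec d) : (a • S) * T = a • (S * T) := rfl

theorem mul_smul_clm (a : ℝ) (S T : Vec d →L[ℝ] Vec d) : S * (a • T) = a • (S * T) :=
  ContinuousLinearMap.ext fun x => map_smul S a (T x)

/-- The linear span of all products. -/
noncomputable def prodSpan : Submodule ℝ (Vec d →L[ℝ] Vec d) :=
  Submodule.span ℝ (range (opProd B))

variable {B}

theorem opProd_mem_prodSpan (s : List (Fin m)) : opProd B s ∈ prodSpan B :=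
  Submodule.subset_span ⟨s, rfl⟩

theorem mul_mem_prodSpan {S T : Vec d →L[ℝ] Vec d} (hS : S ∈ prodSpan B) (hT : T ∈ prodSpan B) :
    S * T ∈ prodSpan B := by
  induction hS using Submodule.span_induction with
  | mem S hS =>
    obtain ⟨s, rfl⟩ := hS
    induction hT using Submodule.span_induction with
    | mem T hT =>
      obtain ⟨t, rfl⟩ := hT
      rw [← opProd_append]
      exact opProd_mem_prodSpan _
    | zero => simp
    | add T T' _ _ h h' => rw [mul_add]; exact add_mem h h'
    | smul a T _ h => rw [mul_smul_clm]; exact Submodule.smul_mem _ a h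
  | zero => simp
  | add S S' _ _ h h' => rw [add_mul]; exact add_mem h h'
  | smul a S _ h => rw [smul_mul_clm]; exact Submodule.smul_mem _ a h

/-- The trace of a continuous operator. -/
noncomputable def opTrace : (Vec d →L[ℝ] Vec d) →ₗ[ℝ] ℝ :=
  LinearMap.trace ℝ (Vec d) ∘ₗ ContinuousLinearMap.coeLM ℝ

theorem opTrace_mul_comm (S T : Vec d →L[ℝ] Vec d) : opTrace (S * T) = opTrace (T * S) :=
  LinearMap.trace_mul_comm ℝ (S : Vec d →ₗ[ℝ] Vec d) (T : Vec d →ₗ[ℝ] Vec d)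

/-- The trace form is nondegenerate on the span of an irreducible semigroup. -/
theorem eq_zero_of_opTrace_mul_eq_zero
    (hirr : ∀ W : Submodule ℝ (Vec d), (∀ i, ∀ x ∈ W, B i x ∈ W) → W = ⊥ ∨ W = ⊤)
    {S : Vec d →L[ℝ] Vec d} (hS : S ∈ prodSpan B) (htr : ∀ t, opTrace (S * opProd B t) = 0) :
    S = 0 := by
  by_contra hS0
  obtain ⟨v, hv⟩ : ∃ v, S v ≠ 0 := by
    by_contra! hall
    exact hS0 (ContinuousLinearMap.ext hall)
  let I : Submodule ℝ (Vec d →L[ℝ] Vec d) :=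
    { carrier := {T | T ∈ prodSpan B ∧ ∀ t, opTrace (T * opProd B t) = 0}
      zero_mem' := ⟨zero_mem _, by simp⟩
      add_mem' := fun {T T'} h h' => ⟨add_mem h.1 h'.1, fun t => by
        rw [add_mul, map_add, h.2, h'.2, add_zero]⟩
      smul_mem' := fun a T h => ⟨Submodule.smul_mem _ a h.1, fun t => by
        rw [smul_mul_clm, map_smul, h.2, smul_zero]⟩ }
  have hI : ∀ T ∈ I, ∀ Z ∈ prodSpan B, opTrace (T * Z) = 0 := by
    intro T hT Z hZ
    induction hZ using Submodule.span_induction with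
    | mem Z hZ => obtain ⟨t, rfl⟩ := hZ; exact hT.2 t
    | zero => simp
    | add Z Z' _ _ h h' => rw [mul_add, map_add, h, h', add_zero]
    | smul a Z _ h => rw [mul_smul_clm, map_smul, h, smul_zero]
  let ev : (Vec d →L[ℝ] Vec d) →ₗ[ℝ] Vec d :=
    (ContinuousLinearMap.apply ℝ (Vec d) v).toLinearMap
  -- Cyclicity of the trace makes `I` stable under left multiplication by `B i`, so `I v` is a
  -- nonzero invariant subspace. It therefore contains `v`: some `Y ∈ I` fixes `v`, while all its
  -- positive powers have trace zero.
  have hU : I.map ev = ⊤ := by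
    refine (hirr _ ?_).resolve_left fun hbot => ?_
    · rintro i _ ⟨T, hT, rfl⟩
      have hBi : B i ∈ prodSpan B := by simpa using opProd_mem_prodSpan (B := B) [i]
      refine ⟨B i * T, ⟨mul_mem_prodSpan hBi hT.1, fun t => ?_⟩, rfl⟩
      rw [mul_assoc, opTrace_mul_comm, mul_assoc]
      exact hI T hT _ (mul_mem_prodSpan (opProd_mem_prodSpan t) hBi)
    · have : ev S ∈ I.map ev := ⟨S, ⟨hS, htr⟩, rfl⟩
      rw [hbot, Submodule.mem_bot] at this
      exact hv this
  obtain ⟨Y, hY, hYv⟩ : v ∈ I.map ev := hU ▸ Submodule.mem_top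
  have hpow : ∀ k, Y ^ k ∈ prodSpan B := by
    intro k
    induction k with
    | zero => simpa using opProd_mem_prodSpan (B := B) []
    | succ k ih => rw [pow_succ]; exact mul_mem_prodSpan ih hY.1
  have hpowtr : ∀ k, LinearMap.trace ℝ (Vec d) ((Y : Vec d →ₗ[ℝ] Vec d) ^ (k + 1)) = 0 := by
    intro k
    have h1 := hI Y hY _ (hpow k)
    rw [← pow_succ'] at h1
    rw [← ContinuousLinearMap.toLinearMap_pow]
    exact h1
  have hv0 : v = 0 := eq_zero_of_trace_pow_eq_zero hpowtr hYv
  exact hv (by rw [hv0, map_zero])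

/-- An irreducible semigroup with bounded traces is bounded. -/
theorem exists_norm_opProd_le
    (hirr : ∀ W : Submodule ℝ (Vec d), (∀ i, ∀ x ∈ W, B i x ∈ W) → W = ⊥ ∨ W = ⊤)
    {c : ℝ} (htr : ∀ s, |opTrace (opProd B s)| ≤ c) : ∃ C, ∀ s, ‖opProd B s‖ ≤ C := by
  by_contra! hunb
  choose s hs using fun n : ℕ => hunb (n + 1)
  have hpos : ∀ n, 0 < ‖opProd B (s n)‖ := fun n => lt_trans (by positivity) (hs n)
  have : ProperSpace (Vec d →L[ℝ] Vec d) := FiniteDimensional.proper ℝ _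
  have hmem : ∀ n, (‖opProd B (s n)‖)⁻¹ • opProd B (s n) ∈
      Metric.sphere (0 : Vec d →L[ℝ] Vec d) 1 := fun n => by
    rw [mem_sphere_zero_iff_norm, norm_smul, norm_inv, norm_norm, inv_mul_cancel₀ (hpos n).ne']
  obtain ⟨X, hX, φ, hφ, hlim⟩ := (isCompact_sphere (0 : Vec d →L[ℝ] Vec d) 1).tendsto_subseq hmem
  have hXspan : X ∈ prodSpan B :=
    (Submodule.closed_of_finiteDimensional (prodSpan B)).mem_of_tendsto hlim
      (Eventually.of_forall fun n => Submodule.smul_mem _ _ (opProd_mem_prodSpan _))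
  -- `X` is a limit of products divided by their norms, which tend to infinity, while the traces
  -- stay bounded.
  have hX0 : X = 0 := by
    refine eq_zero_of_opTrace_mul_eq_zero hirr hXspan fun t => ?_
    have hcont : Continuous fun T : Vec d →L[ℝ] Vec d => opTrace (T * opProd B t) :=
      (LinearMap.continuous_of_finiteDimensional opTrace).comp (continuous_mul_const _)
    refine tendsto_nhds_unique ((hcont.tendsto X).comp hlim) ?_
    have hc : Tendsto (fun n : ℕ => c * (1 / ((n : ℝ) + 1))) atTop (𝓝 0) := by
      simpa using tendsto_one_div_add_atTop_nhds_zero_nat.const_mul c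
    refine squeeze_zero_norm (fun n => ?_) (hc.comp hφ.tendsto_atTop)
    simp only [Function.comp_apply]
    rw [smul_mul_clm, map_smul, ← opProd_append, smul_eq_mul, norm_mul, norm_inv, norm_norm,
      Real.norm_eq_abs, mul_comm]
    have hc0 : 0 ≤ c := (abs_nonneg _).trans (htr [])
    refine mul_le_mul (htr _) ?_ (inv_nonneg.2 (hpos _).le) hc0
    rw [one_div]
    exact inv_anti₀ (by positivity) (hs _).le
  rw [hX0] at hX
  simp at hX

/-- Operators in a bounded set with determinants bounded away from zero have bounded inverses. -/
theorem exists_inverse_bound (C : ℝ) {κ : ℝ} (hκ : 0 < κ) :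
    ∃ D, 0 ≤ D ∧ ∀ T : Vec d →L[ℝ] Vec d, ‖T‖ ≤ C → κ ≤ |T.det| →
      ∃ R : Vec d →L[ℝ] Vec d, ‖R‖ ≤ D ∧ R * T = 1 := by
  have : ProperSpace (Vec d →L[ℝ] Vec d) := FiniteDimensional.proper ℝ _
  set K : Set (Vec d →L[ℝ] Vec d) := {T | ‖T‖ ≤ C ∧ κ ≤ |T.det|} with hK
  have hKc : IsCompact K := by
    refine (isCompact_closedBall (0 : Vec d →L[ℝ] Vec d) C).of_isClosed_subset ?_ fun T hT => ?_
    · exact (isClosed_le continuous_norm continuous_const).inter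
        (isClosed_le continuous_const ContinuousLinearMap.continuous_det.abs)
    · simpa using hT.1
  have hunit : ∀ T ∈ K, IsUnit T := fun T hT => by
    have hdet : T.det ≠ 0 := fun h0 => by
      have := hT.2
      rw [h0, abs_zero] at this
      exact this.not_gt hκ
    refine ⟨(T.toContinuousLinearEquivOfDetNeZero hdet).toUnit, ?_⟩
    ext x
    rfl
  have hcont : ContinuousOn Ring.inverse K := fun T hT => by
    obtain ⟨u, rfl⟩ := hunit T hT
    exact (NormedRing.inverse_continuousAt u).continuousWithinAt
  obtain ⟨D, hD⟩ := hKc.exists_bound_of_continuousOn hcont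
  refine ⟨max D 0, le_max_right _ _, fun T h1 h2 => ⟨Ring.inverse T, ?_, ?_⟩⟩
  · exact (hD T ⟨h1, h2⟩).trans (le_max_left _ _)
  · exact Ring.inverse_mul_cancel T (hunit T ⟨h1, h2⟩)

end Bounded

/-! ### Trace and determinant bounds from eigenvalue bounds. -/

section Eigenvalues

variable {d : ℕ} (M : Matrix (Fin d) (Fin d) ℝ)

theorem charpoly_complexify_roots :
    (M.map (algebraMap ℝ ℂ)).charpoly.roots.card = d := by
  rw [← (IsAlgClosed.splits (M.map (algebraMap ℝ ℂ)).charpoly).natDegree_eq_card_roots,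
    Matrix.charpoly_natDegree_eq_dim, Fintype.card_fin]

variable {M} {ρ : ℝ} (hρ : ∀ μ : ℂ, (M.map (algebraMap ℝ ℂ)).charpoly.IsRoot μ → ‖μ‖ ≤ ρ)
include hρ

theorem abs_trace_le : |M.trace| ≤ d * ρ := by
  have h1 : ((M.trace : ℝ) : ℂ) = (M.map (algebraMap ℝ ℂ)).charpoly.roots.sum := by
    rw [← Matrix.trace_eq_sum_roots_charpoly]
    exact (AddMonoidHom.map_trace (algebraMap ℝ ℂ) M)
  rw [← Real.norm_eq_abs, ← Complex.norm_real, h1]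
  have h2 : ∀ s : Multiset ℂ, (∀ μ ∈ s, ‖μ‖ ≤ ρ) → ‖s.sum‖ ≤ s.card * ρ := by
    intro s
    induction s using Multiset.induction_on with
    | empty => simp
    | cons a s ih =>
      intro hs
      rw [Multiset.sum_cons, Multiset.card_cons]
      push_cast
      have := ih fun μ hμ => hs μ (Multiset.mem_cons_of_mem hμ)
      have := hs a (Multiset.mem_cons_self a s)
      linarith [norm_add_le a s.sum]
  have h3 := h2 _ fun μ hμ => hρ μ (Polynomial.isRoot_of_mem_roots hμ)
  rwa [charpoly_complexify_roots] at h3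

theorem pow_le_abs_det_sub {t : ℝ} (ht : ρ < |t|) :
    (|t| - ρ) ^ d ≤ |(M - t • (1 : Matrix (Fin d) (Fin d) ℝ)).det| := by
  have h0 : |(M - t • (1 : Matrix (Fin d) (Fin d) ℝ)).det| = |M.charpoly.eval t| := by
    rw [Matrix.eval_charpoly, ← neg_sub, Matrix.det_neg, abs_mul, abs_pow, abs_neg, abs_one,
      one_pow, one_mul, Matrix.scalar_apply, Matrix.smul_one_eq_diagonal]
  have h1 : ((M.charpoly.eval t : ℝ) : ℂ) =
      ((M.map (algebraMap ℝ ℂ)).charpoly.roots.map fun μ => (t : ℂ) - μ).prod := by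
    have hsplit := IsAlgClosed.splits (M.map (algebraMap ℝ ℂ)).charpoly
    rw [← hsplit.eval_eq_prod_roots_of_monic (Matrix.charpoly_monic _), Matrix.charpoly_map]
    exact (Polynomial.eval_map_apply (algebraMap ℝ ℂ) t).symm
  rw [h0, ← Real.norm_eq_abs (M.charpoly.eval t), ← Complex.norm_real, h1]
  have h2 : ∀ s : Multiset ℂ, (∀ μ ∈ s, ‖μ‖ ≤ ρ) →
      (|t| - ρ) ^ s.card ≤ ‖(s.map fun μ => (t : ℂ) - μ).prod‖ := by
    intro s
    induction s using Multiset.induction_on with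
    | empty => simp
    | cons a s ih =>
      intro hs
      rw [Multiset.map_cons, Multiset.prod_cons, Multiset.card_cons, norm_mul, pow_succ']
      refine mul_le_mul ?_ (ih fun μ hμ => hs μ (Multiset.mem_cons_of_mem hμ))
        (pow_nonneg (sub_nonneg.2 ht.le) _) (norm_nonneg _)
      have h3 := norm_sub_norm_le (t : ℂ) a
      rw [Complex.norm_real, Real.norm_eq_abs] at h3
      linarith [hs a (Multiset.mem_cons_self a s)]
  have h3 := h2 _ fun μ hμ => hρ μ (Polynomial.isRoot_of_mem_roots hμ)
  rwa [charpoly_complexify_roots] at h3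

end Eigenvalues

end SwitchingSystem

/-! ### The spectral projection of a simple leading eigenvalue. -/

namespace SwitchingSystem

open Filter Topology Set Polynomial Matrix

/-- In a complex Banach algebra, powers of an element with spectrum in the open unit disc decay. -/
theorem tendsto_pow_zero_of_spectrum {A : Type*} [NormedRing A] [NormedAlgebra ℂ A]
    [CompleteSpace A] (a : A) (ha : ∀ μ ∈ spectrum ℂ a, ‖μ‖ < 1) :
    Tendsto (fun k : ℕ => a ^ k) atTop (𝓝 0) := by
  rcases subsingleton_or_nontrivial A with _ | _
  · exact tendsto_const_nhds.congr fun k => Subsingleton.elim _ _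
  have h1 : spectralRadius ℂ a < ((1 : NNReal) : ENNReal) :=
    spectrum.spectralRadius_lt_of_forall_lt a fun μ hμ => by exact_mod_cast ha μ hμ
  obtain ⟨r, hr1, hr2⟩ := ENNReal.lt_iff_exists_nnreal_btwn.1 h1
  have hr2' : r < 1 := by exact_mod_cast hr2
  have h2 := (spectrum.pow_nnnorm_pow_one_div_tendsto_nhds_spectralRadius a).eventually_lt_const hr1
  have h3 : Tendsto (fun k : ℕ => ((r : ℝ)) ^ k) atTop (𝓝 0) :=
    tendsto_pow_atTop_nhds_zero_of_lt_one r.coe_nonneg (by exact_mod_cast hr2')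
  refine squeeze_zero_norm' ?_ h3
  filter_upwards [h2, eventually_gt_atTop 0] with k hk hk0
  have hk0' : (0 : ℝ) < k := by exact_mod_cast hk0
  have h4 := (ENNReal.rpow_le_rpow hk.le hk0'.le)
  rw [← ENNReal.rpow_mul, one_div_mul_cancel hk0'.ne', ENNReal.rpow_one, ENNReal.rpow_natCast] at h4
  exact_mod_cast h4

variable {d : ℕ}

theorem op_one : op (1 : Matrix (Fin d) (Fin d) ℝ) = 1 := map_one _

theorem op_mul (M N : Matrix (Fin d) (Fin d) ℝ) : op (M * N) = op M * op N := map_mul _ M N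

theorem op_smul (a : ℝ) (M : Matrix (Fin d) (Fin d) ℝ) : op (a • M) = a • op M := map_smul _ a M

theorem op_pow (M : Matrix (Fin d) (Fin d) ℝ) (k : ℕ) : op (M ^ k) = op M ^ k := map_pow _ M k

theorem op_pow_tendsto_zero {M : Matrix (Fin d) (Fin d) ℝ}
    (hM : ∀ μ ∈ spectrum ℂ (M.map (algebraMap ℝ ℂ)), ‖μ‖ < 1) :
    Tendsto (fun k : ℕ => op (M ^ k)) atTop (𝓝 0) := by
  have h1 : Tendsto (fun k : ℕ => (M.map (algebraMap ℝ ℂ)) ^ k) atTop (𝓝 0) := by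
    open scoped Matrix.Norms.L2Operator in
    exact tendsto_pow_zero_of_spectrum _ hM
  have h2 : Tendsto (fun k : ℕ => M ^ k) atTop (𝓝 0) := by
    have hre : Continuous fun N : Matrix (Fin d) (Fin d) ℂ => N.map Complex.re :=
      continuous_id.matrix_map Complex.continuous_re
    have h3 := (hre.tendsto 0).comp h1
    have h4 : (0 : Matrix (Fin d) (Fin d) ℂ).map Complex.re = 0 := by ext; simp
    rw [h4] at h3
    refine h3.congr fun k => ?_
    rw [Function.comp_apply, ← Matrix.map_pow]
    ext i j
    simp
  have hcont : Continuous fun N : Matrix (Fin d) (Fin d) ℝ => op N :=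
    LinearMap.continuous_of_finiteDimensional
      (Matrix.toEuclideanCLM (n := Fin d) (𝕜 := ℝ)).toAlgEquiv.toLinearMap
  have h5 := (hcont.tendsto 0).comp h2
  simp only [map_zero] at h5
  exact h5

theorem aeval_map_complexify (M : Matrix (Fin d) (Fin d) ℝ) (p : ℝ[X]) :
    (aeval M p).map (algebraMap ℝ ℂ) =
      aeval (M.map (algebraMap ℝ ℂ)) (p.map (algebraMap ℝ ℂ)) := by
  rw [aeval_map_algebraMap]
  exact (aeval_algHom_apply (Algebra.ofId ℝ ℂ).mapMatrix M p).symm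

variable {P : Matrix (Fin d) (Fin d) ℝ} {z : ℂ}

theorem aeval_charpoly_eq_eval (μ : ℂ) :
    aeval μ P.charpoly = (P.map (algebraMap ℝ ℂ)).charpoly.eval μ := by
  rw [Matrix.charpoly_map, aeval_def, eval_map]

theorem aeval_conj (p : ℝ[X]) (μ : ℂ) :
    aeval ((starRingEnd ℂ) μ) p = (starRingEnd ℂ) (aeval μ p) :=
  aeval_algHom_apply Complex.conjAe.toAlgHom μ p

theorem IsUniqueSimpleLeading.isRoot (hz : IsUniqueSimpleLeading P z) :
    (P.map (algebraMap ℝ ℂ)).charpoly.IsRoot z :=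
  (rootMultiplicity_pos (Matrix.charpoly_monic _).ne_zero).1 (by rw [hz.1]; exact one_pos)

theorem IsUniqueSimpleLeading.norm_le (hz : IsUniqueSimpleLeading P z) {μ : ℂ}
    (hμ : (P.map (algebraMap ℝ ℂ)).charpoly.IsRoot μ) : ‖μ‖ ≤ ‖z‖ := by
  by_cases h1 : μ = z
  · rw [h1]
  by_cases h2 : μ = (starRingEnd ℂ) z
  · rw [h2, RCLike.norm_conj]
  exact (hz.2 μ hμ h1 h2).le

/-- The factor of the characteristic polynomial that belongs to a simple leading eigenvalue is
coprime to the cofactor. -/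
theorem IsUniqueSimpleLeading.exists_factorization (hz : IsUniqueSimpleLeading P z) :
    ∃ g h u t : ℝ[X], P.charpoly = g * h ∧ u * g + t * h = 1 ∧
      (∀ p : ℝ[X], aeval z p = 0 → g ∣ p) ∧ ∀ μ : ℂ, aeval μ h = 0 → ‖μ‖ < ‖z‖ := by
  have hroot : aeval z P.charpoly = 0 := by
    rw [aeval_charpoly_eq_eval]
    exact hz.isRoot
  have hint : IsIntegral ℝ z := Algebra.IsIntegral.isIntegral z
  obtain ⟨h, hh⟩ := minpoly.dvd ℝ z hroot
  have hχ0 : P.charpoly ≠ 0 := (Matrix.charpoly_monic P).ne_zero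
  -- Otherwise both the minimal polynomial and its cofactor vanish at `z`, and `z` is a multiple
  -- root.
  have hhz : aeval z h ≠ 0 := by
    intro hz0
    have h0 : (minpoly ℝ z * h).map (algebraMap ℝ ℂ) ≠ 0 := by
      rw [← hh]
      exact (Polynomial.map_ne_zero_iff (algebraMap ℝ ℂ).injective).2 hχ0
    have h1 := hz.1
    rw [Matrix.charpoly_map, hh, Polynomial.map_mul, rootMultiplicity_mul (by
      rwa [← Polynomial.map_mul])] at h1
    rw [Polynomial.map_mul] at h0
    have h2 : 0 < rootMultiplicity z ((minpoly ℝ z).map (algebraMap ℝ ℂ)) :=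
      (rootMultiplicity_pos (left_ne_zero_of_mul h0)).2 (by
        rw [IsRoot, eval_map_algebraMap, minpoly.aeval])
    have h3 : 0 < rootMultiplicity z (h.map (algebraMap ℝ ℂ)) :=
      (rootMultiplicity_pos (right_ne_zero_of_mul h0)).2 (by
        rw [IsRoot, eval_map_algebraMap, hz0])
    omega
  obtain ⟨u, t, hut⟩ : IsCoprime (minpoly ℝ z) h := by
    refine (minpoly.irreducible hint).coprime_iff_not_dvd.2 fun hdvd => hhz ?_
    obtain ⟨k, rfl⟩ := hdvd
    rw [map_mul, minpoly.aeval, zero_mul]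
  refine ⟨_, h, u, t, hh, hut, fun p hp => minpoly.dvd ℝ z hp, fun μ hμ => ?_⟩
  refine hz.2 μ ?_ ?_ ?_
  · rw [IsRoot, ← aeval_charpoly_eq_eval, hh, map_mul, hμ, mul_zero]
  · rintro rfl
    exact hhz hμ
  · rintro rfl
    rw [aeval_conj, map_eq_zero] at hμ
    exact hhz hμ

/-- `Q` is the Bézout idempotent `(t * h)(P)`. On its kernel only roots of `h` act, all of modulus
below `‖z‖`. On its range `g(P) = 0` by Cayley–Hamilton, hence so is every real polynomial in `P`
vanishing at `z`. -/
theorem IsUniqueSimpleLeading.exists_proj (hz : IsUniqueSimpleLeading P z) (hz0 : z ≠ 0) :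
    ∃ Q : Vec d →L[ℝ] Vec d,
      Tendsto (fun k : ℕ => (‖z‖⁻¹ • op P) ^ k * (1 - Q)) atTop (𝓝 0) ∧
      ∀ p : ℝ[X], aeval z p = 0 → ∀ x, op (aeval P p) (Q x) = 0 := by
  obtain ⟨g, h, u, t, hχ, hut, hdvd, hlt⟩ := hz.exists_factorization
  have hzpos : 0 < ‖z‖ := norm_pos_iff.2 hz0
  refine ⟨op (aeval P (t * h)), ?_, fun p hp x => ?_⟩
  · have hsub : 1 - op (aeval P (t * h)) = op (aeval P (u * g)) := by
      rw [sub_eq_iff_eq_add, ← map_add, ← map_add, hut, map_one, map_one]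
    have hidem : IsIdempotentElem (aeval P (u * g)) := by
      have h1 : u * g - u * g * (u * g) = (u * t) * P.charpoly := by
        rw [hχ]
        calc u * g - u * g * (u * g) = u * g * (1 - u * g) := by ring
          _ = u * g * (t * h) := by rw [← hut]; ring
          _ = _ := by ring
      have h2 : aeval P (u * g - u * g * (u * g)) = 0 := by
        rw [h1, map_mul, Matrix.aeval_self_charpoly, mul_zero]
      rw [map_sub, map_mul _ (u * g) (u * g), sub_eq_zero] at h2
      exact h2.symm
    -- The idempotent survives only in positive powers, hence the shift of the index here and in the
    -- limit.
    have hpow : ∀ k : ℕ, aeval P (C ‖z‖⁻¹ * X * (u * g)) ^ (k + 1) =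
        (‖z‖⁻¹ • P) ^ (k + 1) * aeval P (u * g) := fun k => by
      rw [← map_pow, mul_pow, map_mul, map_pow, map_pow, hidem.pow_succ_eq, map_mul, aeval_C,
        aeval_X, ← Algebra.smul_def]
    have hN : ∀ μ ∈ spectrum ℂ ((aeval P (C ‖z‖⁻¹ * X * (u * g))).map (algebraMap ℝ ℂ)),
        ‖μ‖ < 1 := by
      intro μ hμ
      rw [aeval_map_complexify, spectrum.map_polynomial_aeval_of_nonempty _ _
        ⟨z, Matrix.mem_spectrum_iff_isRoot_charpoly.2 hz.isRoot⟩] at hμ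
      obtain ⟨ν, hν, rfl⟩ := hμ
      have h1 : aeval ν P.charpoly = 0 := by
        rw [aeval_charpoly_eq_eval]
        exact Matrix.mem_spectrum_iff_isRoot_charpoly.1 hν
      have h2 : eval ν ((C ‖z‖⁻¹ * X * (u * g)).map (algebraMap ℝ ℂ)) =
          ((‖z‖⁻¹ : ℝ) : ℂ) * ν * (aeval ν u * aeval ν g) := by
        rw [eval_map_algebraMap]
        simp
      simp only [h2]
      rw [hχ, map_mul, mul_eq_zero] at h1
      rcases h1 with h1 | h1
      · simp [h1]
      · have h3 := congrArg (aeval ν) hut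
        rw [map_add, map_mul, map_mul, h1, mul_zero, add_zero, map_one] at h3
        rw [h3, mul_one, norm_mul, Complex.norm_real, norm_inv, norm_norm, inv_mul_lt_iff₀ hzpos,
          mul_one]
        exact hlt ν h1
    have hlim := op_pow_tendsto_zero hN
    rw [hsub, ← tendsto_add_atTop_iff_nat 1]
    rw [← tendsto_add_atTop_iff_nat 1] at hlim
    refine hlim.congr fun k => ?_
    rw [hpow]
    generalize aeval P (u * g) = e
    rw [op_mul, op_pow, op_smul]
  · obtain ⟨q, rfl⟩ := hdvd p hp
    have h1 : aeval P (g * q) * aeval P (t * h) = 0 := by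
      have h2 : g * q * (t * h) = q * t * P.charpoly := by rw [hχ]; ring
      rw [← map_mul, h2, map_mul, Matrix.aeval_self_charpoly, mul_zero]
    have h3 : op (aeval P (g * q)) * op (aeval P (t * h)) = 0 := by
      rw [← map_mul, h1, map_zero]
    exact congrArg (fun T : Vec d →L[ℝ] Vec d => T x) h3

/-- Geometric multiplicity is at most algebraic multiplicity, which is one. -/
theorem exists_eigenline {K : Type*} [Field K] (M : Matrix (Fin d) (Fin d) K) {a : K}
    (ha : M.charpoly.rootMultiplicity a = 1) :
    ∃ v : Fin d → K, v ≠ 0 ∧ M *ᵥ v = a • v ∧ ∀ x, M *ᵥ x = a • x → ∃ c : K, x = c • v := by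
  have hroot : M.charpoly.IsRoot a :=
    (rootMultiplicity_pos (Matrix.charpoly_monic _).ne_zero).1 (by rw [ha]; exact one_pos)
  have hfin : Module.finrank K (Module.End.eigenspace (Matrix.toLin' M) a) ≤ 1 := by
    have := LinearMap.finrank_genEigenspace_le (Matrix.toLin' M) a 1
    rwa [Matrix.charpoly_toLin', ha, Nat.cast_one] at this
  obtain ⟨⟨v, hv⟩, hspan⟩ := finrank_le_one_iff.1 hfin
  have hspan' : ∀ x, M *ᵥ x = a • x → ∃ c : K, x = c • v := fun x hx => by
    obtain ⟨c, hc⟩ := hspan ⟨x, Module.End.mem_eigenspace_iff.2 (by simpa using hx)⟩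
    exact ⟨c, (congrArg Subtype.val hc).symm⟩
  refine ⟨v, ?_, by simpa using Module.End.mem_eigenspace_iff.1 hv, hspan'⟩
  rintro rfl
  have heig : Module.End.HasEigenvalue (Matrix.toLin' M) a := by
    rw [Module.End.hasEigenvalue_iff_isRoot_charpoly, Matrix.charpoly_toLin']
    exact hroot
  obtain ⟨y, hy⟩ := heig.exists_hasEigenvector
  obtain ⟨c, hc⟩ := hspan' y (by simpa using hy.apply_eq_smul)
  exact hy.2 (by simpa using hc)

end SwitchingSystem

/-! ### Leading sets: a pair of points or an ellipse. -/

namespace SwitchingSystem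

open Filter Topology Set Polynomial Matrix

variable {d : ℕ} {P : Matrix (Fin d) (Fin d) ℝ} {z : ℂ}

theorem op_sub (M N : Matrix (Fin d) (Fin d) ℝ) : op (M - N) = op M - op N := map_sub _ M N

theorem op_zero : op (0 : Matrix (Fin d) (Fin d) ℝ) = 0 := map_zero _

theorem op_add (M N : Matrix (Fin d) (Fin d) ℝ) : op (M + N) = op M + op N := map_add _ M N

theorem op_apply (M : Matrix (Fin d) (Fin d) ℝ) (x : Vec d) (i : Fin d) :
    op M x i = (M *ᵥ x.ofLp) i := rfl

/-- The leading set of a dominant product with real leading eigenvalue: a pair `{v, -v}`. -/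
theorem IsUniqueSimpleLeading.exists_real_leadingSet (hz : IsUniqueSimpleLeading P z)
    (hz0 : z ≠ 0) (him : z.im = 0) :
    ∃ (Q : Vec d →L[ℝ] Vec d) (v : Vec d), IsLeadingSet (‖z‖⁻¹ • op P) Q {v, -v} := by
  obtain ⟨Q, hlim, hQ⟩ := hz.exists_proj hz0
  have hzre : z = algebraMap ℝ ℂ z.re := Complex.ext (by simp) (by simp [him])
  have hzn : ‖z‖ = |z.re| := by
    rw [hzre]
    simp
  have hre0 : z.re ≠ 0 := fun h0 => hz0 (by rw [hzre, h0, map_zero])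
  have hmult : P.charpoly.rootMultiplicity z.re = 1 := by
    rw [eq_rootMultiplicity_map (algebraMap ℝ ℂ).injective, ← Matrix.charpoly_map, ← hzre, hz.1]
  obtain ⟨v, hv0, hv, hspan⟩ := exists_eigenline P hmult
  set σ := ‖z‖⁻¹ * z.re with hσ
  have hσ2 : σ = 1 ∨ σ = -1 := by
    rw [hσ, hzn]
    rcases abs_choice z.re with h | h <;> rw [h]
    · exact Or.inl (inv_mul_cancel₀ hre0)
    · right
      rw [inv_neg, neg_mul, inv_mul_cancel₀ hre0]
  set x₀ : Vec d := WithLp.toLp 2 v with hx₀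
  have hx₀0 : x₀ ≠ 0 := fun h0 => hv0 (by simpa [hx₀] using h0)
  have hop : op P x₀ = z.re • x₀ := by
    ext i
    rw [op_apply, hv]
    rfl
  have hT : (‖z‖⁻¹ • op P) x₀ = σ • x₀ := by
    rw [_root_.smul_apply, hop, smul_smul]
  have hpm : ∀ {τ : ℝ}, τ = 1 ∨ τ = -1 → τ • x₀ ∈ ({x₀, -x₀} : Set (Vec d)) := by
    rintro τ (rfl | rfl) <;> simp
  have hpm' : ∀ {x : Vec d}, x ∈ ({x₀, -x₀} : Set (Vec d)) →
      ∃ τ : ℝ, (τ = 1 ∨ τ = -1) ∧ x = τ • x₀ := by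
    rintro x (rfl | rfl)
    · exact ⟨1, by simp, by simp⟩
    · exact ⟨-1, by simp, by simp⟩
  refine ⟨Q, x₀, ?_, ⟨x₀, by simp⟩, ?_, ?_, ?_, fun x => ?_, ?_, hlim⟩
  · exact (Set.toFinite _).isCompact
  · rintro (h0 | h0)
    · exact hx₀0 h0.symm
    · exact hx₀0 (by simpa using h0.symm)
  · rintro x (rfl | rfl) <;> simp
  · rw [image_pair, map_neg, hT]
    rcases hσ2 with h | h <;> rw [h]
    · simp
    · simp [Set.pair_comm]
  · have h1 := hQ (X - C z.re) (by
      rw [map_sub, aeval_X, aeval_C, ← hzre, sub_self]) x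
    rw [map_sub, aeval_X, aeval_C, Algebra.algebraMap_eq_smul_one] at h1
    obtain ⟨c, hc⟩ := hspan (Q x).ofLp (by
      have h2 : op P (Q x) - z.re • Q x = 0 := by
        rw [← h1, op_sub, op_smul, op_one]
        rfl
      rw [sub_eq_zero] at h2
      exact congrArg WithLp.ofLp h2)
    have hc' : Q x = c • x₀ := by
      ext i
      exact congrFun hc i
    rcases le_total 0 c with h0 | h0
    · exact ⟨c, h0, x₀, by simp, hc'⟩
    · exact ⟨-c, neg_nonneg.2 h0, -x₀, by simp, by rw [hc', smul_neg, neg_smul, neg_neg]⟩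
  · intro x hx y hy δ hδ N
    have hpow : ∀ k : ℕ, ((‖z‖⁻¹ • op P) ^ k) x₀ = σ ^ k • x₀ := by
      intro k
      induction k with
      | zero => simp
      | succ k ih =>
        rw [pow_succ', ContinuousLinearMap.mul_def, ContinuousLinearMap.comp_apply, ih, map_smul,
          hT, smul_smul, pow_succ]
    -- The normalised eigenvalue `σ` is `±1`, so even powers fix `E`; recurrence up to sign covers
    -- the pair.
    have h1 : ((‖z‖⁻¹ • op P) ^ (2 * N)) x = x := by
      obtain ⟨τ, -, rfl⟩ := hpm' hx
      rw [map_smul, hpow, pow_mul]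
      rcases hσ2 with h | h <;> simp [h]
    refine ⟨2 * N, by omega, ?_⟩
    rw [h1]
    rcases hx with rfl | rfl <;> rcases hy with rfl | rfl <;> simp [hδ]

/-- The real points `Re (c v)` of a complex line, as a function of the complex coordinate `c`. -/
noncomputable def lineRe (a b : Vec d) : ℂ →ₗ[ℝ] Vec d where
  toFun c := c.re • a - c.im • b
  map_add' c c' := by simp only [Complex.add_re, Complex.add_im]; module
  map_smul' r c := by
    simp only [Complex.real_smul, Complex.re_ofReal_mul, Complex.im_ofReal_mul, RingHom.id_apply]
    module

theorem lineRe_apply (a b : Vec d) (c : ℂ) : lineRe a b c = c.re • a - c.im • b := rfl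

theorem ellipse_eq_image (a b : Vec d) :
    ellipse a (-b) = lineRe a b '' {c : ℂ | ‖c‖ = 1} := by
  ext x
  constructor
  · rintro ⟨p, hp, rfl⟩
    refine ⟨⟨p.1, p.2⟩, ?_, by simp [lineRe_apply, sub_eq_add_neg]⟩
    have : ‖(⟨p.1, p.2⟩ : ℂ)‖ ^ 2 = 1 := by
      rw [Complex.sq_norm, Complex.normSq_mk, ← hp]
      ring
    exact (pow_eq_one_iff_of_nonneg (norm_nonneg _) two_ne_zero).1 this
  · rintro ⟨c, hc, rfl⟩
    refine ⟨(c.re, c.im), ?_, by simp [lineRe_apply, sub_eq_add_neg]⟩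
    have h1 := Complex.sq_norm c
    rw [hc, Complex.normSq_apply] at h1
    change c.re ^ 2 + c.im ^ 2 = 1
    linarith

/-- Powers of a unimodular number with irrational argument come close to every point of the unit
circle infinitely often. -/
theorem exists_pow_close_of_irrational {ζ : ℂ} (hζ : ‖ζ‖ = 1)
    (hirr : Irrational (Complex.arg ζ / Real.pi)) {c : ℂ} (hc : ‖c‖ = 1) {δ : ℝ} (hδ : 0 < δ)
    (N : ℕ) : ∃ k ≥ N, ‖ζ ^ k - c‖ < δ := by
  have hirr2 : Irrational (Complex.arg ζ / (2 * Real.pi)) := by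
    have h1 : Complex.arg ζ / (2 * Real.pi) = Complex.arg ζ / Real.pi / (2 : ℕ) := by
      push_cast
      rw [div_div, mul_comm]
    rw [h1]
    exact hirr.div_natCast two_ne_zero
  set u : Circle := ⟨ζ, mem_sphere_zero_iff_norm.2 hζ⟩ with hu
  have hdense : DenseRange (fun n : ℤ => u ^ n) := by
    have h1 := (AddCircle.homeomorphCircle Real.two_pi_pos.ne').surjective.denseRange.comp
      (AddCircle.denseRange_zsmul_coe_iff.2 hirr2)
      (AddCircle.homeomorphCircle Real.two_pi_pos.ne').continuous
    convert h1 using 2 with n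
    rw [Function.comp_apply, AddCircle.homeomorphCircle_apply, AddCircle.toCircle_zsmul, AddCircle.toCircle_apply_mk,
      div_self Real.two_pi_pos.ne', one_mul]
    congr 1
    exact (Circle.exp_arg u).symm
  have hmem : (⟨c, mem_sphere_zero_iff_norm.2 hc⟩ : Circle) ∈
      closure (range fun n : ℤ => u ^ n) := hdense _
  -- In the compact circle group, a point in the closure of the integer powers is a cluster point of
  -- the natural powers.
  have hcl := ((mapClusterPt_atTop_pow_tfae _ u).out 3 0).1 hmem
  have hev : ∀ᶠ y : Circle in 𝓝 ⟨c, mem_sphere_zero_iff_norm.2 hc⟩, ‖(y : ℂ) - c‖ < δ := by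
    have hcont : Continuous fun y : Circle => ‖(y : ℂ) - c‖ := by fun_prop
    exact hcont.continuousAt.eventually_lt continuousAt_const (by simpa using hδ)
  obtain ⟨k, hk, hlt⟩ := frequently_atTop.1 (hcl.frequently hev) N
  exact ⟨k, hk, hlt⟩

theorem not_irrational_arg_div_pi {z : ℂ} (h0 : z.im = 0) :
    ¬ Irrational (Complex.arg z / Real.pi) := by
  intro hirr
  rcases le_or_gt 0 z.re with hre | hre
  · rw [Complex.arg_eq_zero_iff.2 ⟨hre, h0⟩] at hirr
    simp at hirr
  · rw [Complex.arg_eq_pi_iff.2 ⟨hre, h0⟩, div_self Real.pi_ne_zero] at hirr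
    simp at hirr

/-- The leading set of a dominant product with leading eigenvalue of irrational argument: an
ellipse. -/
theorem IsUniqueSimpleLeading.exists_ellipse_leadingSet (hz : IsUniqueSimpleLeading P z)
    (hirr : Irrational (Complex.arg z / Real.pi)) :
    ∃ (Q : Vec d →L[ℝ] Vec d) (x y : Vec d), IsLeadingSet (‖z‖⁻¹ • op P) Q (ellipse x y) := by
  have hz0 : z ≠ 0 := by
    rintro rfl
    simp at hirr
  have him : z.im ≠ 0 := fun h0 => not_irrational_arg_div_pi h0 hirr
  obtain ⟨Q, hlim, hQ⟩ := hz.exists_proj hz0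
  obtain ⟨v, hv0, hv, hspan⟩ := exists_eigenline _ hz.1
  have hzpos : 0 < ‖z‖ := norm_pos_iff.2 hz0
  set a : Vec d := WithLp.toLp 2 fun i => (v i).re with ha
  set b : Vec d := WithLp.toLp 2 fun i => (v i).im with hb
  set ψ := lineRe a b with hψ
  have hψ_apply : ∀ c i, ψ c i = (c * v i).re := fun c i => by
    simp [hψ, lineRe_apply, ha, hb]
  -- `ψ c = Re (c v)` turns `P` into multiplication by `z`, so the normalised operator acts on the
  -- ellipse `ψ(|c| = 1)` as a rotation of the parameter.
  have hP : ∀ c, op P (ψ c) = ψ (z * c) := by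
    intro c
    ext i
    have h1 := congrArg (fun ζ => (c * ζ).re) (congrFun hv i)
    rw [hψ_apply, op_apply, mul_comm z c, mul_assoc]
    rw [Pi.smul_apply, smul_eq_mul] at h1
    rw [← h1]
    simp only [Matrix.mulVec, dotProduct, hψ_apply, Finset.mul_sum, Complex.re_sum]
    refine Finset.sum_congr rfl fun j _ => ?_
    simp
    ring
  have hT : ∀ c, (‖z‖⁻¹ • op P) (ψ c) = ψ (z / ‖z‖ * c) := by
    intro c
    rw [_root_.smul_apply, hP, ← map_smul, Complex.real_smul, Complex.ofReal_inv]
    congr 1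
    ring
  have hinj : ∀ c, ψ c = 0 → c = 0 := by
    intro c hc
    by_contra hc0
    apply hv0
    funext i
    have h1 : (c * v i).re = 0 := by rw [← hψ_apply, hc]; rfl
    have h2 : (z * c * v i).re = 0 := by rw [← hψ_apply, ← hP, hc, map_zero]; rfl
    rw [mul_assoc, Complex.mul_re, h1, mul_zero, zero_sub, neg_eq_zero, mul_eq_zero] at h2
    have h3 : c * v i = 0 := Complex.ext h1 (h2.resolve_left him)
    exact (mul_eq_zero.1 h3).resolve_left hc0
  have hψcont : Continuous ψ := LinearMap.continuous_of_finiteDimensional ψ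
  have hζ : ‖z / ‖z‖‖ = 1 := by
    rw [norm_div, Complex.norm_real, norm_norm, div_self hzpos.ne']
  have hrange : ∀ x, ∃ c, Q x = ψ c := by
    intro x
    have h1 := hQ (X ^ 2 - C (2 * z.re) * X + C (‖z‖ ^ 2)) (by
      have h2 : ((2 * z.re : ℝ) : ℂ) = z + (starRingEnd ℂ) z := (Complex.add_conj z).symm
      have h3 : ((‖z‖ ^ 2 : ℝ) : ℂ) = z * (starRingEnd ℂ) z := by
        rw [Complex.mul_conj']
        push_cast
        rfl
      rw [map_add, map_sub, map_mul, map_pow, aeval_X, aeval_C, aeval_C, Complex.coe_algebraMap,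
        h2, h3]
      ring) x
    set y := Q x with hy
    have h2 : ∀ i, op P (op P y) i = 2 * z.re * op P y i - ‖z‖ ^ 2 * y i := by
      intro i
      rw [map_add, map_sub, map_mul, map_pow, aeval_X, aeval_C, aeval_C,
        Algebra.algebraMap_eq_smul_one, Algebra.algebraMap_eq_smul_one, smul_mul_assoc, one_mul,
        op_add, op_sub, op_pow, op_smul, op_smul, op_one, pow_two] at h1
      have h3 : op P (op P y) i - (2 * z.re) * op P y i + ‖z‖ ^ 2 * y i = 0 :=
        congrArg (fun u : Vec d => u i) h1
      linarith
    -- On the range of `Q`, `(P - z)(P - conj z) = 0`, so `(P - conj z) y` lies on the eigenline of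
    -- `z` and equals some `c v`. As `y` and `P y` are real, its imaginary part is `z.im • y`, which
    -- gives the witness below.
    have h3 : P.map (algebraMap ℝ ℂ) *ᵥ (fun i => (op P y i : ℂ) - (starRingEnd ℂ) z * (y i : ℂ)) =
        z • fun i => (op P y i : ℂ) - (starRingEnd ℂ) z * (y i : ℂ) := by
      funext i
      have hcoe : ∀ u : Vec d, ((op P u i : ℝ) : ℂ) = ∑ j, (P i j : ℂ) * (u j : ℂ) := fun u => by
        rw [op_apply, Matrix.mulVec, dotProduct]
        push_cast
        rfl
      have h4 : (P.map (algebraMap ℝ ℂ) *ᵥ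
          (fun i => (op P y i : ℂ) - (starRingEnd ℂ) z * (y i : ℂ))) i =
          (op P (op P y) i : ℂ) - (starRingEnd ℂ) z * (op P y i : ℂ) := by
        rw [hcoe (op P y), hcoe y, Finset.mul_sum, ← Finset.sum_sub_distrib]
        change ∑ j, (P i j : ℂ) * ((op P y j : ℂ) - (starRingEnd ℂ) z * (y j : ℂ)) = _
        refine Finset.sum_congr rfl fun j _ => ?_
        ring
      rw [h4, h2]
      have h5 : (2 * z.re : ℂ) = z + (starRingEnd ℂ) z := by
        rw [Complex.add_conj]
        push_cast
        rfl
      have h6 : (‖z‖ ^ 2 : ℂ) = z * (starRingEnd ℂ) z := (Complex.mul_conj' z).symm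
      push_cast
      rw [h5, h6, Pi.smul_apply, smul_eq_mul]
      ring
    obtain ⟨c, hc⟩ := hspan _ h3
    refine ⟨z.im⁻¹ • (-Complex.I * c), ?_⟩
    ext i
    have h4 := congrArg Complex.im (congrFun hc i)
    rw [hψ_apply, smul_mul_assoc, Complex.smul_re, neg_mul, neg_mul, mul_assoc, Complex.neg_re,
      Complex.I_mul_re, neg_neg, smul_eq_mul, eq_inv_mul_iff_mul_eq₀ him]
    rw [Pi.smul_apply, smul_eq_mul] at h4
    rw [← h4]
    simp
  refine ⟨Q, a, -b, ?_⟩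
  rw [ellipse_eq_image]
  refine ⟨?_, ⟨ψ 1, 1, by simp, rfl⟩, ?_, ?_, ?_, fun x => ?_, ?_, hlim⟩
  · have : {c : ℂ | ‖c‖ = 1} = Metric.sphere 0 1 := by ext; simp
    rw [this]
    exact (isCompact_sphere 0 1).image hψcont
  · rintro ⟨c, hc, h0⟩
    rw [hinj c h0] at hc
    simp at hc
  · rintro _ ⟨c, hc, rfl⟩
    exact ⟨-c, by simpa using hc, map_neg ψ c⟩
  · apply Subset.antisymm
    · rintro _ ⟨_, ⟨c, hc, rfl⟩, rfl⟩
      refine ⟨_, ?_, (hT c).symm⟩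
      change ‖_‖ = 1
      rw [norm_mul, hζ, one_mul]
      exact hc
    · rintro _ ⟨c, hc, rfl⟩
      have hζ0 : z / ‖z‖ ≠ 0 := norm_pos_iff.1 (hζ ▸ one_pos)
      refine ⟨_, ⟨(z / ‖z‖)⁻¹ * c, ?_, rfl⟩, ?_⟩
      · change ‖_‖ = 1
        rw [norm_mul, norm_inv, hζ, inv_one, one_mul]
        exact hc
      · rw [← hψ, hT, mul_inv_cancel_left₀ hζ0]
  · obtain ⟨c, hc⟩ := hrange x
    rcases eq_or_ne c 0 with rfl | hc0
    · exact ⟨0, le_rfl, ψ 1, ⟨1, by simp, rfl⟩, by rw [hc, map_zero, zero_smul]⟩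
    · have hcpos : 0 < ‖c‖ := norm_pos_iff.2 hc0
      refine ⟨‖c‖, norm_nonneg _, _, ⟨‖c‖⁻¹ • c, ?_, rfl⟩, ?_⟩
      · change ‖_‖ = 1
        rw [norm_smul, norm_inv, norm_norm, inv_mul_cancel₀ hcpos.ne']
      · rw [hc, map_smul, smul_inv_smul₀ hcpos.ne']
  · rintro _ ⟨c, hc, rfl⟩ _ ⟨c', hc', rfl⟩ δ hδ N
    have hpow : ∀ k : ℕ, ((‖z‖⁻¹ • op P) ^ k) (ψ c) = ψ ((z / ‖z‖) ^ k * c) := by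
      intro k
      induction k with
      | zero => simp
      | succ k ih =>
        rw [pow_succ', ContinuousLinearMap.mul_def, ContinuousLinearMap.comp_apply, ih, hT,
          pow_succ', mul_assoc]
    have hc0 : c ≠ 0 := by
      rintro rfl
      simp at hc
    set L := ψ.toContinuousLinearMap
    have hargs : Complex.arg (z / ‖z‖) = Complex.arg z := by
      have := Complex.arg_real_mul z (inv_pos.2 hzpos)
      rwa [Complex.ofReal_inv, mul_comm, ← div_eq_mul_inv] at this
    obtain ⟨k, hk, hlt⟩ := exists_pow_close_of_irrational hζ (by rwa [hargs])
      (c := c' / c) (by rw [norm_div, hc, hc', div_one]) (δ := δ / (‖L‖ + 1)) (by positivity) N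
    refine ⟨k, hk, Or.inl ?_⟩
    rw [← hψ, hpow, ← map_sub]
    have h1 : (z / ‖z‖) ^ k * c - c' = ((z / ‖z‖) ^ k - c' / c) * c := by
      rw [sub_mul, div_mul_cancel₀ _ hc0]
    have h2 : ‖(z / ‖z‖) ^ k * c - c'‖ < δ / (‖L‖ + 1) := by
      rw [h1, norm_mul, hc, mul_one]
      exact hlt
    calc ‖ψ ((z / ‖z‖) ^ k * c - c')‖ ≤ ‖L‖ * ‖(z / ‖z‖) ^ k * c - c'‖ := L.le_opNorm _
      _ ≤ ‖L‖ * (δ / (‖L‖ + 1)) := by gcongr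
      _ < δ := by
        have h3 : δ / (‖L‖ + 1) * (‖L‖ + 1) = δ := by field_simp
        have h4 : 0 < δ / (‖L‖ + 1) := by positivity
        nlinarith

end SwitchingSystem

/-! ### Normalisation by `q` and the joint spectral radius. -/

namespace SwitchingSystem

open Filter Topology Set

section SpectralRadius

variable {d : ℕ} {M : Matrix (Fin d) (Fin d) ℝ}

theorem norm_le_specRad {μ : ℂ} (hμ : (M.map (algebraMap ℝ ℂ)).charpoly.IsRoot μ) :
    ‖μ‖ ≤ specRad M := by
  have hmem := Matrix.mem_spectrum_iff_isRoot_charpoly.2 hμ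
  have hne : Nonempty (Fin d) := by
    by_contra hemp
    rw [not_nonempty_iff] at hemp
    simp [Matrix.charpoly] at hμ
  have hfin : spectralRadius ℂ (M.map (algebraMap ℝ ℂ)) ≠ ⊤ := by
    open scoped Matrix.Norms.L2Operator in
    obtain ⟨ν, -, hν⟩ := spectrum.exists_nnnorm_eq_spectralRadius (M.map (algebraMap ℝ ℂ))
    rw [← hν]
    exact ENNReal.coe_ne_top
  have h1 : (‖μ‖₊ : ENNReal) ≤ spectralRadius ℂ (M.map (algebraMap ℝ ℂ)) :=
    le_iSup₂ (f := fun (k : ℂ) (_ : k ∈ spectrum ℂ (M.map (algebraMap ℝ ℂ))) =>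
      (‖k‖₊ : ENNReal)) μ hmem
  exact ENNReal.toReal_mono hfin h1

theorem specRad_le {r : ℝ} (hr : 0 ≤ r)
    (hM : ∀ μ : ℂ, (M.map (algebraMap ℝ ℂ)).charpoly.IsRoot μ → ‖μ‖ ≤ r) : specRad M ≤ r := by
  refine ENNReal.toReal_le_of_le_ofReal hr (iSup₂_le fun μ hμ => ?_)
  exact (ofReal_norm μ).symm.trans_le
    (ENNReal.ofReal_le_ofReal (hM μ (Matrix.mem_spectrum_iff_isRoot_charpoly.1 hμ)))

theorem IsUniqueSimpleLeading.specRad_eq {z : ℂ} (hz : IsUniqueSimpleLeading M z) :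
    specRad M = ‖z‖ :=
  le_antisymm (specRad_le (norm_nonneg _) fun _ hμ => hz.norm_le hμ) (norm_le_specRad hz.isRoot)

theorem norm_le_pow_of_isRoot_pow {r : ℝ}
    (hM : ∀ μ : ℂ, (M.map (algebraMap ℝ ℂ)).charpoly.IsRoot μ → ‖μ‖ ≤ r) (n : ℕ) {μ : ℂ}
    (hμ : ((M ^ n).map (algebraMap ℝ ℂ)).charpoly.IsRoot μ) : ‖μ‖ ≤ r ^ n := by
  have hmem := Matrix.mem_spectrum_iff_isRoot_charpoly.2 hμ
  have hne : Nonempty (Fin d) := by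
    by_contra hemp
    rw [not_nonempty_iff] at hemp
    simp [Matrix.charpoly] at hμ
  have hne' : (spectrum ℂ (M.map (algebraMap ℝ ℂ))).Nonempty :=
    spectrum.nonempty_of_isAlgClosed_of_finiteDimensional ℂ _
  rw [Matrix.map_pow] at hmem
  have himg := spectrum.map_polynomial_aeval_of_nonempty (M.map (algebraMap ℝ ℂ))
    (Polynomial.X ^ n) hne'
  rw [map_pow, Polynomial.aeval_X] at himg
  rw [himg] at hmem
  obtain ⟨ν, hν, rfl⟩ := hmem
  simp only [Polynomial.eval_pow, Polynomial.eval_X, norm_pow]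
  exact pow_le_pow_left₀ (norm_nonneg _) (hM ν (Matrix.mem_spectrum_iff_isRoot_charpoly.1 hν)) n

end SpectralRadius

section Words

variable {d m : ℕ} (A : Fin m → Matrix (Fin d) (Fin d) ℝ)

@[simp]
theorem wordProd_nil : wordProd A [] = 1 := by
  simp [wordProd]

theorem wordProd_append (s t : List (Fin m)) :
    wordProd A (s ++ t) = wordProd A t * wordProd A s := by
  simp [wordProd]

@[simp]
theorem wordProd_singleton (i : Fin m) : wordProd A [i] = A i := by
  simp [wordProd]

theorem wordProd_wordPow (v : List (Fin m)) (n : ℕ) :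
    wordProd A (wordPow v n) = wordProd A v ^ n := by
  induction n with
  | zero => simp
  | succ n ih => rw [wordPow_add, wordProd_append, wordPow_one, ih, pow_succ']

theorem charpoly_wordProd_of_isRotated {v w : List (Fin m)} (h : List.IsRotated w v) :
    (wordProd A v).charpoly = (wordProd A w).charpoly := by
  obtain ⟨r, hr, rfl⟩ := List.isRotated_iff_mod.1 h
  rw [List.rotate_eq_drop_append_take hr, wordProd_append, Matrix.charpoly_mul_comm,
    ← wordProd_append, List.take_append_drop]

/-- The family normalised by the factor `q⁻¹`. -/
noncomputable def normalized (q : ℝ) (i : Fin m) : Vec d →L[ℝ] Vec d := q⁻¹ • op (A i)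

theorem opProd_normalized (q : ℝ) (s : List (Fin m)) :
    opProd (normalized A q) s = (q⁻¹) ^ s.length • op (wordProd A s) := by
  induction s using List.reverseRecOn with
  | nil => simp
  | append_singleton s i ih =>
    rw [opProd_append, opProd_singleton, ih, wordProd_append, wordProd_singleton, op_mul,
      mul_smul_clm, normalized, smul_mul_clm, smul_smul, List.length_append,
      List.length_singleton, pow_succ]

variable {A} {w : List (Fin m)} {z : ℂ}

/-- The eigenvalue bounds contained in the definition of a unique dominant product. -/
theorem IsUniqueDominant.exists_rate (hw : IsUniqueDominant A w)
    (hz : IsUniqueSimpleLeading (wordProd A w) z) :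
    ∃ q ε : ℝ, 0 ≤ q ∧ 0 < ε ∧ ε < 1 ∧ q ^ w.length = ‖z‖ ∧
      (∀ s, ∀ μ : ℂ, ((wordProd A s).map (algebraMap ℝ ℂ)).charpoly.IsRoot μ →
        ‖μ‖ ≤ q ^ s.length) ∧
      ∀ s, ¬ IsRotPow w s → ∀ μ : ℂ,
        ((wordProd A s).map (algebraMap ℝ ℂ)).charpoly.IsRoot μ →
          ‖μ‖ ≤ (1 - ε) * q ^ s.length := by
  obtain ⟨q, hq, ε, hε0, hε1, hgap⟩ := hw.gap
  have hwne : w ≠ [] := (hw.primitive w rfl).1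
  have hwlen : w.length ≠ 0 := by simpa using hwne
  have hqw := hq w rfl
  rw [nu, hz.specRad_eq] at hqw
  have hq0 : 0 ≤ q := hqw ▸ Real.rpow_nonneg (norm_nonneg _) _
  have hqz : q ^ w.length = ‖z‖ := by
    rw [← hqw, one_div, Real.rpow_inv_natCast_pow (norm_nonneg _) hwlen]
  have hnon : ∀ s, ¬ IsRotPow w s → ∀ μ : ℂ,
      ((wordProd A s).map (algebraMap ℝ ℂ)).charpoly.IsRoot μ →
        ‖μ‖ ≤ (1 - ε) * q ^ s.length := by
    intro s hs μ hμ
    have hsne : s ≠ [] := by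
      rintro rfl
      exact hs ⟨w, List.IsRotated.refl w, 0, by simp⟩
    have hslen : s.length ≠ 0 := by simpa using hsne
    have h1 := hgap s hsne (by
      rintro ⟨w', rfl, v, hv, n, hn⟩
      exact hs ⟨v, hv, n, hn⟩)
    have hspec : 0 ≤ specRad (wordProd A s) := ENNReal.toReal_nonneg
    have h2 := pow_le_pow_left₀ (Real.rpow_nonneg hspec _) h1 s.length
    rw [one_div, Real.rpow_inv_natCast_pow hspec hslen, mul_pow,
      Real.rpow_inv_natCast_pow (by linarith) hslen] at h2
    exact (norm_le_specRad hμ).trans h2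
  refine ⟨q, ε, hq0, hε0, hε1, hqz, fun s μ hμ => ?_, hnon⟩
  -- Rotating a word does not change the characteristic polynomial, so powers of rotations inherit
  -- their bound from the leading eigenvalue of `w`.
  by_cases hs : IsRotPow w s
  · obtain ⟨v, hv, n, rfl⟩ := hs
    rw [length_wordPow, mul_comm, pow_mul, ← hv.perm.length_eq, hqz]
    rw [wordProd_wordPow] at hμ
    refine norm_le_pow_of_isRoot_pow (fun ν hν => hz.norm_le ?_) n hμ
    rwa [Matrix.charpoly_map, ← charpoly_wordProd_of_isRotated A hv, ← Matrix.charpoly_map]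
  · refine (hnon s hs μ hμ).trans ?_
    have := pow_nonneg hq0 s.length
    nlinarith

end Words

section Normalized

variable {d m : ℕ} {A : Fin m → Matrix (Fin d) (Fin d) ℝ} {w : List (Fin m)} {z : ℂ} {q ρ : ℝ}

theorem op_coe_eq_toLin (M : Matrix (Fin d) (Fin d) ℝ) : (op M : Vec d →ₗ[ℝ] Vec d) =
    Matrix.toLin (PiLp.basisFun 2 ℝ (Fin d)) (PiLp.basisFun 2 ℝ (Fin d)) M := by
  rw [← Matrix.toLpLin_eq_toLin]
  rfl

theorem opTrace_op (M : Matrix (Fin d) (Fin d) ℝ) : opTrace (op M) = M.trace := by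
  change LinearMap.trace ℝ (Vec d) (op M : Vec d →ₗ[ℝ] Vec d) = _
  rw [op_coe_eq_toLin, Matrix.trace_toLin_eq]

theorem det_op (M : Matrix (Fin d) (Fin d) ℝ) : (op M).det = M.det := by
  change LinearMap.det (op M : Vec d →ₗ[ℝ] Vec d) = _
  rw [op_coe_eq_toLin, LinearMap.det_toLin]

/-- Eigenvalue bounds become operator bounds: normalised traces are at most `d`, which bounds all
products, and `|det (S - μ)| ≥ (|μ| - ρ) ^ d` for non-dominant `S`, which bounds the inverses. -/
theorem exists_dominance (hirr : IsIrreducible A) (hwne : w ≠ []) (hq : 0 < q) (hρ0 : 0 ≤ ρ)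
    (hρ1 : ρ < 1) (hqz : q ^ w.length = ‖z‖)
    (hall : ∀ s, ∀ μ : ℂ, ((wordProd A s).map (algebraMap ℝ ℂ)).charpoly.IsRoot μ →
      ‖μ‖ ≤ q ^ s.length)
    (hnon : ∀ s, ¬ IsRotPow w s → ∀ μ : ℂ,
      ((wordProd A s).map (algebraMap ℝ ℂ)).charpoly.IsRoot μ → ‖μ‖ ≤ ρ * q ^ s.length)
    {Q : Vec d →L[ℝ] Vec d} {E : Set (Vec d)}
    (hE : IsLeadingSet (‖z‖⁻¹ • op (wordProd A w)) Q E) :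
    ∃ C, Dominance (normalized A q) w Q E C ρ := by
  have hirr' : ∀ W : Submodule ℝ (Vec d), (∀ i, ∀ x ∈ W, normalized A q i x ∈ W) →
      W = ⊥ ∨ W = ⊤ := by
    intro W hW
    refine hirr W fun i x hx => ?_
    have h1 := W.smul_mem q (hW i x hx)
    rwa [normalized, _root_.smul_apply, smul_inv_smul₀ hq.ne'] at h1
  obtain ⟨C, hC⟩ := exists_norm_opProd_le hirr' (c := d) fun s => by
    rw [opProd_normalized, map_smul, opTrace_op, smul_eq_mul, abs_mul, abs_pow, abs_inv,
      abs_of_pos hq, inv_pow, inv_mul_le_iff₀ (pow_pos hq _), mul_comm]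
    exact abs_trace_le (hall s)
  refine ⟨C, ⟨?_, hC, hirr', hρ0, hρ1, fun μ hμ => ?_, hwne⟩⟩
  · rwa [opProd_normalized, inv_pow, hqz]
  · have hκ : 0 < (|μ| - ρ) ^ d := pow_pos (sub_pos.2 hμ) d
    obtain ⟨D, hD0, hD⟩ := exists_inverse_bound (d := d) (C + ‖μ • (1 : Vec d →L[ℝ] Vec d)‖) hκ
    refine ⟨D, hD0, fun s hs => hD _ ?_ ?_⟩
    · exact (norm_sub_le _ _).trans (add_le_add_left (hC s) _)
    · have hqs : 0 < q ^ s.length := pow_pos hq _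
      have h1 : opProd (normalized A q) s - μ • 1 =
          op ((q ^ s.length)⁻¹ • (wordProd A s - (μ * q ^ s.length) • 1)) := by
        rw [opProd_normalized, op_smul, op_sub, op_smul, op_one, smul_sub, smul_smul, inv_pow]
        congr 2
        field_simp
      have h2 := pow_le_abs_det_sub (M := wordProd A s) (hnon s hs) (t := μ * q ^ s.length) (by
        rw [abs_mul, abs_of_pos hqs]
        exact mul_lt_mul_of_pos_right hμ hqs)
      rw [h1, det_op, Matrix.det_smul, Fintype.card_fin, abs_mul, abs_pow, abs_inv,
        abs_of_pos hqs, inv_pow, le_inv_mul_iff₀ (pow_pos hqs _), ← mul_pow]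
      refine le_of_eq_of_le ?_ h2
      rw [abs_mul, abs_of_pos hqs]
      ring

/-- A power of `w` carries some point of `E` to a fixed `x ∈ E`, and the part after its prefix of
length `n` has norm at most `C`, so the prefix cannot be small. -/
theorem Dominance.exists_norm_lower_bound {B : Fin m → Vec d →L[ℝ] Vec d}
    {Q : Vec d →L[ℝ] Vec d} {E : Set (Vec d)} {C : ℝ} (h : Dominance B w Q E C ρ) :
    ∃ c > 0, ∀ n, ∃ s : List (Fin m), s.length = n ∧ c ≤ ‖opProd B s‖ := by
  obtain ⟨M, hM0, hM⟩ := h.exists_norm_bound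
  obtain ⟨x, hx⟩ := h.nonempty
  have hx0 : 0 < ‖x‖ := norm_pos_iff.2 fun h0 => h.zero_notMem (h0 ▸ hx)
  have hC := h.const_nonneg
  refine ⟨‖x‖ / ((C + 1) * M), by positivity, fun n => ?_⟩
  have hsurj : ∀ k : ℕ, ∃ e ∈ E, (opProd B w ^ k) e = x := by
    intro k
    induction k with
    | zero => exact ⟨x, hx, rfl⟩
    | succ k ih =>
      obtain ⟨e, he, hex⟩ := ih
      rw [← h.image_eq] at he
      obtain ⟨e', he', rfl⟩ := he
      exact ⟨e', he', by rw [pow_succ]; exact hex⟩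
  obtain ⟨e, he, hex⟩ := hsurj n
  have hlen : n ≤ (wordPow w n).length := by
    rw [length_wordPow]
    exact Nat.le_mul_of_pos_right n (List.length_pos_iff.2 h.word_ne)
  refine ⟨(wordPow w n).take n, by simpa using hlen, ?_⟩
  rw [← opProd_wordPow, ← List.take_append_drop n (wordPow w n), opProd_append] at hex
  have heM : ‖e‖ ≤ M := by simpa using hM [] e he
  rw [div_le_iff₀ (by positivity)]
  calc ‖x‖ = ‖opProd B ((wordPow w n).drop n) (opProd B ((wordPow w n).take n) e)‖ :=
        congrArg _ hex.symm
    _ ≤ ‖opProd B ((wordPow w n).drop n)‖ * (‖opProd B ((wordPow w n).take n)‖ * ‖e‖) :=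
        (ContinuousLinearMap.le_opNorm _ _).trans
          (mul_le_mul_of_nonneg_left (ContinuousLinearMap.le_opNorm _ _) (norm_nonneg _))
    _ ≤ (C + 1) * (‖opProd B ((wordPow w n).take n)‖ * M) := by
        gcongr
        linarith [h.norm_le ((wordPow w n).drop n)]
    _ = _ := by ring

theorem jsr_eq_of_bounds (hq : 0 < q) {c C : ℝ} (hc : 0 < c)
    (hC : ∀ s, ‖opProd (normalized A q) s‖ ≤ C)
    (hlow : ∀ n, ∃ s : List (Fin m), s.length = n ∧ c ≤ ‖opProd (normalized A q) s‖) :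
    jsr A = q := by
  have hC0 : 0 < C := by
    obtain ⟨s, -, hs⟩ := hlow 0
    exact hc.trans_le (hs.trans (hC s))
  have hnorm : ∀ s : List (Fin m), ‖op (wordProd A s)‖ =
      q ^ s.length * ‖opProd (normalized A q) s‖ := fun s => by
    rw [opProd_normalized, norm_smul, norm_pow, norm_inv, Real.norm_of_nonneg hq.le, inv_pow,
      mul_inv_cancel_left₀ (pow_pos hq _).ne']
  have hterm : ∀ (n : ℕ), n ≠ 0 → ∀ s : List (Fin m), s.length = n →
      ‖op (wordProd A s)‖ ^ (1 / (n : ℝ)) =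
        q * ‖opProd (normalized A q) s‖ ^ (1 / (n : ℝ)) := by
    intro n hn s hs
    rw [hnorm, hs, Real.mul_rpow (pow_nonneg hq.le _) (norm_nonneg _), one_div,
      Real.pow_rpow_inv_natCast hq.le hn]
  have hroot : ∀ a : ℝ, 0 < a → Tendsto (fun n : ℕ => q * a ^ (1 / (n : ℝ))) atTop (𝓝 q) := by
    intro a ha
    have h1 : Tendsto (fun n : ℕ => a ^ (1 / (n : ℝ))) atTop (𝓝 (a ^ (0 : ℝ))) :=
      (Real.continuousAt_const_rpow ha.ne').tendsto.comp tendsto_one_div_atTop_nhds_zero_nat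
    simpa using h1.const_mul q
  refine (tendsto_of_tendsto_of_tendsto_of_le_of_le' (hroot c hc) (hroot C hC0) ?_ ?_).limUnder_eq
  · filter_upwards [eventually_ne_atTop 0] with n hn
    obtain ⟨s, rfl, hs⟩ := hlow n
    calc q * c ^ (1 / (s.length : ℝ))
        ≤ q * ‖opProd (normalized A q) s‖ ^ (1 / (s.length : ℝ)) := by gcongr
      _ = ‖op (wordProd A (List.ofFn s.get))‖ ^ (1 / (s.length : ℝ)) := by
          rw [List.ofFn_get, hterm _ hn s rfl]
      _ ≤ _ := le_ciSup (f := fun v : Fin s.length → Fin m =>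
          ‖op (wordProd A (List.ofFn v))‖ ^ (1 / (s.length : ℝ))) (Set.finite_range _).bddAbove _
  · filter_upwards [eventually_ne_atTop 0] with n hn
    obtain ⟨s, rfl, -⟩ := hlow n
    have : Nonempty (Fin s.length → Fin m) := ⟨s.get⟩
    refine ciSup_le fun v => ?_
    rw [hterm _ hn _ (List.length_ofFn)]
    gcongr
    exact hC _

theorem isInvariantBody_iff (hq : 0 < q) (hjsr : jsr A = q) {G : Set (Vec d)} :
    IsInvariantBody A G ↔ IsFixedBody (normalized A q) G := by
  have h1 : (⋃ i, op (A i) '' G) = q • ⋃ i, normalized A q i '' G := by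
    rw [smul_set_iUnion]
    refine iUnion_congr fun i => ?_
    rw [← image_smul, image_image]
    refine image_congr fun x _ => ?_
    rw [normalized, _root_.smul_apply, smul_inv_smul₀ hq.ne']
  rw [IsInvariantBody, IsFixedBody, h1, convexHull_smul, hjsr]
  refine and_congr_right fun _ => ⟨fun h => ?_, fun h => by rw [h]⟩
  rw [← inv_smul_smul₀ hq.ne' (convexHull ℝ (⋃ i, normalized A q i '' G)), h,
    inv_smul_smul₀ hq.ne']

end Normalized

end SwitchingSystem

/-! ### Finite hulls, the degenerate case and the conclusion. -/

namespace SwitchingSystem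

open Filter Topology Set

section Hulls

variable {d : ℕ}

theorem image_ellipse (T : Vec d →L[ℝ] Vec d) (x y : Vec d) :
    T '' ellipse x y = ellipse (T x) (T y) := by
  rw [ellipse, ellipse, image_image]
  refine image_congr fun p _ => ?_
  rw [map_add, map_smul, map_smul]

theorem isPolytope_of_finite {G K : Set (Vec d)} (hK : K.Finite) (hG : G = convexHull ℝ K) :
    IsPolytope G := by
  lift K to Finset (Vec d) using hK
  exact ⟨K, hG⟩

theorem isHullOfEllipses_of_finite {α : Type*} {G : Set (Vec d)} {F : Set α} (hF : F.Finite)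
    (x y : α → Vec d) (hG : G = convexHull ℝ (⋃ p ∈ F, ellipse (x p) (y p))) :
    IsHullOfEllipses G := by
  obtain ⟨N, f, rfl⟩ : ∃ (N : ℕ) (f : Fin N → α), range f = F := by
    have := hF.fintype
    exact ⟨Fintype.card F, fun i => ((Fintype.equivFin F).symm i : F), by
      ext a
      constructor
      · rintro ⟨i, rfl⟩
        exact ((Fintype.equivFin F).symm i).2
      · exact fun ha => ⟨Fintype.equivFin F ⟨a, ha⟩, by simp⟩⟩
  exact ⟨N, fun i => x (f i), fun i => y (f i), by rw [hG, biUnion_range]⟩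

end Hulls

section Nilpotent

variable {m : ℕ} {A : Fin m → Matrix (Fin 1) (Fin 1) ℝ}

/-- In dimension one, a nonempty family of zero matrices has the unit ball as its only invariant
body, up to scaling. -/
theorem zero_family_dim_one [Nonempty (Fin m)] (hA : ∀ i, A i = 0) :
    ∃ G : Set (Vec 1), IsInvariantBody A G ∧
      (∀ G' : Set (Vec 1), IsInvariantBody A G' → ∃ c : ℝ, 0 < c ∧ G' = c • G) ∧
      IsPolytope G := by
  have hjsr : jsr A = 0 := by
    refine (tendsto_const_nhds.congr' ?_).limUnder_eq
    filter_upwards [eventually_ne_atTop 0] with n hn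
    have h0 : ∀ v : Fin n → Fin m, ‖op (wordProd A (List.ofFn v))‖ ^ (1 / (n : ℝ)) = 0 := by
      intro v
      obtain ⟨n, rfl⟩ := Nat.exists_eq_succ_of_ne_zero hn
      rw [List.ofFn_succ, ← List.singleton_append, wordProd_append, wordProd_singleton, hA,
        mul_zero, op_zero, norm_zero, Real.zero_rpow (by positivity)]
    simp only [h0, ciSup_const]
  -- Both sides of the invariance equation are `{0}`, so uniqueness up to scaling comes from
  -- dimension one alone.
  have hinv : ∀ G : Set (Vec 1), IsSymmConvexBody G → IsInvariantBody A G := by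
    intro G hG
    refine ⟨hG, ?_⟩
    have hne : G.Nonempty := ⟨0, hG.zero_mem⟩
    have h1 : ∀ i, op (A i) '' G = {0} := fun i => by
      rw [hA, op_zero]
      exact hne.image_const 0
    simp only [h1, iUnion_const, convexHull_singleton]
    rw [hjsr, zero_smul_set hne]
    rfl
  have hball : IsSymmConvexBody (Metric.closedBall (0 : Vec 1) 1) := by
    refine ⟨convex_closedBall _ _, isCompact_closedBall _ _, ?_, fun x hx => by simpa using hx⟩
    rw [interior_closedBall _ one_ne_zero]
    exact ⟨0, by simp⟩
  have hnorm : ∀ x : Vec 1, ‖x‖ = |x 0| := fun x => by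
    rw [EuclideanSpace.norm_eq]
    simp [Real.sqrt_sq_eq_abs]
  refine ⟨_, hinv _ hball, fun G' hG' => ?_, ?_⟩
  · obtain ⟨r, hr, hrball⟩ := hG'.1.exists_ball
    obtain ⟨y, hy, hmax⟩ := hG'.1.compact.exists_isMaxOn ⟨0, hG'.1.zero_mem⟩
      continuous_norm.continuousOn
    have hypos : 0 < ‖y‖ := by
      have h1 := hmax (hrball (WithLp.toLp 2 fun _ => r / 2) (by
        rw [hnorm]
        change |r / 2| < r
        rw [abs_of_pos (half_pos hr)]
        exact half_lt_self hr))
      refine lt_of_lt_of_le ?_ h1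
      rw [norm_pos_iff]
      intro h0
      have h2 : r / 2 = 0 := congrArg (fun u : Vec 1 => u 0) h0
      exact (half_pos hr).ne' h2
    refine ⟨‖y‖, hypos, ?_⟩
    rw [smul_closedBall' hypos.ne', smul_zero, norm_norm, mul_one]
    refine Subset.antisymm (fun x hx => by simpa using hmax hx) fun x hx => ?_
    have hx' : ‖x‖ ≤ ‖y‖ := by simpa using hx
    have hy0 : y 0 ≠ 0 := by
      rw [hnorm] at hypos
      exact abs_pos.1 hypos
    have hxy : x = (x 0 / y 0) • y := by
      ext i
      rw [Subsingleton.elim i 0]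
      simp [hy0]
    have habs : |x 0 / y 0| ≤ 1 := by
      rw [abs_div, div_le_one (abs_pos.2 hy0), ← hnorm, ← hnorm]
      exact hx'
    rw [hxy]
    rcases le_total 0 (x 0 / y 0) with h0 | h0
    · exact hG'.1.smul_mem hy h0 (by rwa [abs_of_nonneg h0] at habs)
    · rw [abs_of_nonpos h0] at habs
      have := hG'.1.smul_mem (hG'.1.symm y hy) (neg_nonneg.2 h0) habs
      simpa using this
  · set e : Vec 1 := WithLp.toLp 2 fun _ => 1 with he
    refine isPolytope_of_finite (K := {e, -e}) (Set.toFinite _) (Subset.antisymm ?_ ?_)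
    · intro x hx
      have hx' : |x 0| ≤ 1 := by rw [← hnorm]; simpa using hx
      rw [abs_le] at hx'
      rw [convexHull_pair]
      refine ⟨(1 + x 0) / 2, (1 - x 0) / 2, by linarith, by linarith, by ring, ?_⟩
      ext i
      rw [Subsingleton.elim i 0]
      simp [he]
      ring
    · refine convexHull_min ?_ (convex_closedBall _ _)
      have hen : ‖e‖ = 1 := by rw [hnorm]; simp [he]
      rintro x (rfl | rfl) <;> simp [hen]

end Nilpotent

/-- If the leading eigenvalue is zero, then so are all the others; simplicity then forces dimension
one. -/
theorem IsUniqueSimpleLeading.dim_eq_one {d : ℕ} {M : Matrix (Fin d) (Fin d) ℝ}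
    (hz : IsUniqueSimpleLeading M 0) : d = 1 := by
  have h1 : ∀ μ ∈ (M.map (algebraMap ℝ ℂ)).charpoly.roots, μ = 0 := fun μ hμ =>
    norm_le_zero_iff.1 (by simpa using hz.norm_le (Polynomial.isRoot_of_mem_roots hμ))
  rw [← charpoly_complexify_roots M, ← Multiset.count_eq_card.2 fun μ hμ => (h1 μ hμ).symm,
    Polynomial.count_roots, hz.1]

end SwitchingSystem

open SwitchingSystem in
theorem theorem2p1 (d m : ℕ) (A : Fin m → Matrix (Fin d) (Fin d) ℝ)
    (hirr : SwitchingSystem.IsIrreducible A)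
    (w : List (Fin m)) (hw : SwitchingSystem.IsUniqueDominant A w)
    (z : ℂ) (hz : SwitchingSystem.IsUniqueSimpleLeading (SwitchingSystem.wordProd A w) z)
    (harg : z.im = 0 ∨ Irrational (Complex.arg z / Real.pi)) :
    ∃ G : Set (EuclideanSpace ℝ (Fin d)),
      SwitchingSystem.IsInvariantBody A G ∧
      (∀ G' : Set (EuclideanSpace ℝ (Fin d)), SwitchingSystem.IsInvariantBody A G' →
        ∃ c : ℝ, 0 < c ∧ G' = c • G) ∧
      (z.im = 0 → SwitchingSystem.IsPolytope G) ∧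
      (Irrational (Complex.arg z / Real.pi) → SwitchingSystem.IsHullOfEllipses G) := by
  have hwne : w ≠ [] := (hw.primitive w rfl).1
  obtain ⟨q, ε, hq0, hε0, hε1, hqz, hall, hnon⟩ := hw.exists_rate hz
  rcases hq0.eq_or_lt with rfl | hq
  -- With `q = 0` all eigenvalues of all products vanish. Simplicity of `z = 0` forces `d = 1`, and
  -- then every `A i` is zero, having trace zero.
  · have hz0 : z = 0 := by
      rw [zero_pow (by simpa using hwne), eq_comm, norm_eq_zero] at hqz
      exact hqz
    subst hz0
    obtain rfl := hz.dim_eq_one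
    have : Nonempty (Fin m) := ⟨w.head hwne⟩
    have hA : ∀ i, A i = 0 := by
      intro i
      have h1 := abs_trace_le (M := A i) (ρ := 0) fun μ hμ => by
        simpa using hall [i] μ (by simpa using hμ)
      ext a b
      rw [Subsingleton.elim a 0, Subsingleton.elim b 0]
      simpa [Matrix.trace_fin_one] using h1
    obtain ⟨G, hG, huniq, hpoly⟩ := zero_family_dim_one hA
    exact ⟨G, hG, huniq, fun _ => hpoly, fun h => absurd h (not_irrational_arg_div_pi rfl)⟩
  have hz0 : z ≠ 0 := norm_pos_iff.1 (hqz ▸ pow_pos hq _)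
  have main : ∀ {Q : Vec d →L[ℝ] Vec d} {E : Set (Vec d)},
      IsLeadingSet (‖z‖⁻¹ • op (wordProd A w)) Q E →
      ∃ G : Set (Vec d), IsInvariantBody A G ∧
        (∀ G' : Set (Vec d), IsInvariantBody A G' → ∃ c : ℝ, 0 < c ∧ G' = c • G) ∧
        ∃ F : Set (List (Fin m)), F.Finite ∧
          G = convexHull ℝ (⋃ p ∈ F, opProd (normalized A q) p '' E) := by
    intro Q E hE
    obtain ⟨C, hdom⟩ := exists_dominance hirr hwne hq (sub_nonneg.2 hε1.le) (by linarith) hqz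
      hall hnon hE
    obtain ⟨c, hc, hlow⟩ := hdom.exists_norm_lower_bound
    have hjsr := jsr_eq_of_bounds hq hc hdom.norm_le hlow
    refine ⟨orbitHull (normalized A q) E, (isInvariantBody_iff hq hjsr).2 hdom.isFixedBody_orbitHull,
      fun G' hG' => hdom.eq_smul_orbitHull ((isInvariantBody_iff hq hjsr).1 hG'),
      hdom.exists_finite_hull⟩
  rcases harg with him | hirr'
  · obtain ⟨Q, v, hE⟩ := hz.exists_real_leadingSet hz0 him
    obtain ⟨G, hG, huniq, F, hF, hGF⟩ := main hE
    refine ⟨G, hG, huniq, fun _ => isPolytope_of_finite ?_ hGF, fun h => absurd h (not_irrational_arg_div_pi him)⟩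
    exact hF.biUnion fun p _ => (Set.toFinite _).image _
  · obtain ⟨Q, x, y, hE⟩ := hz.exists_ellipse_leadingSet hirr'
    obtain ⟨G, hG, huniq, F, hF, hGF⟩ := main hE
    simp only [image_ellipse] at hGF
    exact ⟨G, hG, huniq, fun h => absurd hirr' (not_irrational_arg_div_pi h),
      fun _ => isHullOfEllipses_of_finite hF _ _ hGF⟩
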